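/- **Proposition (prop:smallFun).** Let $\mathrm{Sim}$ be the category freely generated by the simplex category $\Delta$ together with one new object $[\epsilon]$ and one arrow $[1]\to[\epsilon]$. An $\epsilon$-simplicial set is a presheaf of sets on $\mathrm{Sim}$, i.e. a simplicial set $X$ with a set $X(\epsilon)$ of witnesses and a map $X(\epsilon)\to X_1$; the edges in the image are called $\epsilon$-edges. Simplicial sets are regarded as $\epsilon$-simplicial sets without witnesses. Let $\mathrm{Sim}^n$ be $\Delta^n$ with a single witness, lying over the edge from $0$ to $n$. Its face $\partial_i\mathrm{Sim}^n$ is the face $\partial_i\Delta^n$ opposite to the vertex $i$, together with the witness when the edge from $0$ to $n$ lies in that face. For $n\ge 1$ the $\epsilon$-horns are ${}^{\epsilon}\Lambda^n_0=\bigcup_{i=1}^{n}\partial_i\mathrm{Sim}^n$ and ${}^{\epsilon}\Lambda^n_n=\bigcup_{i=0}^{n-1}\partial_i\mathrm{Sim}^n$, as subobjects of $\mathrm{Sim}^n$. The reduction $X_{\mathrm{red}}=X\amalg_{\mathrm{sk}_0X}\Delta^0$ is obtained from $X$ by identifying all vertices (here $\mathrm{sk}_0 X$ and $\Delta^0$ have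 no witnesses). A class of morphisms is weakly saturated if it is closed under pushouts, retracts and transfinite compositions; the weakly saturated class generated by a class of morphisms is the smallest weakly saturated class containing it. In the category of $\epsilon$-simplicial sets, let $\mathcal L_1$ be the weakly saturated class generated by the inclusions * ${}^{\epsilon}\Lambda^n_0\subset\mathrm{Sim}^n$ and ${}^{\epsilon}\Lambda^n_n\subset\mathrm{Sim}^n$ for $n\ge 1$, * $\partial\Delta^n\subset\Delta^n$ for $n\ge 3$, * $\partial_0\Delta^3\cup\partial_2\Delta^3\subset\Delta^3$, * $\Lambda^n_i\subset\Delta^n$ for $n\ge 3$ and $0\le i\le n$. Let $C=\Delta^1\times(\Delta^1)_{\mathrm{red}}$ be the cylinder, viewed as a square with vertices $(v,h)$, $v,h\in\{0,1\}$, whose vertical sides $h=0$ and $h=1$ are identified. Let $\mathcal L_2$ be the weakly saturated class generated by $\mathcal L_1$ and the two braiding inclusions $C_{\mathrm{low}}\subset C$ and $C_{\mathrm{up}}\subset C$, where $C_{\mathrm{low}}$ is generated by the $2$-simplex $(0,0),(0,1),(1,1)$ and $C_{\mathrm{up}}$ is generated by the $2$-simplex $(0,0),(1,0),(1,1)$.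 Then for $i=1,2$ and every $f\colon A\to B$ in $\mathcal L_i$, the pushout-product $$f\mathbin{\Box}\bigl(\emptyset\to(\mathrm{Sim}^1)_{\mathrm{red}}\bigr)\colon\ \bigl(A\times(\mathrm{Sim}^1)_{\mathrm{red}}\bigr)\amalg_{A\times\emptyset}\bigl(B\times\emptyset\bigr)\longrightarrow B\times(\mathrm{Sim}^1)_{\mathrm{red}}$$ belongs to $\mathcal L_i$. (The products are cartesian products of $\epsilon$-simplicial sets.) -/

import Mathlib

open CategoryTheory Limits MonoidalCategory Opposite

/-- The objects of the category freely generated by the simplex category and one arrow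
`[1] ⟶ [ε]` to a new object `[ε]`. -/
inductive EpsCat : Type
  | simplex (n : SimplexCategory) : EpsCat
  | eps : EpsCat

namespace EpsCat

/-- Every morphism `[m] ⟶ [ε]` factors uniquely through the generating arrow `[1] ⟶ [ε]`, so it is
recorded by a morphism `[m] ⟶ [1]`; the only morphism out of `[ε]` is the identity. -/
def Hom : EpsCat → EpsCat → Type
  | simplex m, simplex n => m ⟶ n
  | simplex m, eps => m ⟶ SimplexCategory.mk 1
  | eps, simplex _ => Empty
  | eps, eps => Unit

/-- Identities. -/
def idHom : ∀ a : EpsCat, Hom a a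
  | simplex n => 𝟙 n
  | eps => ()

/-- Composition. -/
def compHom : ∀ {a b c : EpsCat}, Hom a b → Hom b c → Hom a c
  | simplex _, simplex _, simplex _, f, g => CategoryStruct.comp (obj := SimplexCategory) f g
  | simplex _, simplex _, eps, f, g => CategoryStruct.comp (obj := SimplexCategory) f g
  | simplex _, eps, eps, f, _ => f
  | eps, eps, eps, _, _ => ()
  | simplex _, eps, simplex _, _, g => g.elim
  | eps, simplex _, _, f, _ => f.elim
  | eps, eps, simplex _, _, g => g.elim

instance : Category EpsCat where
  Hom := Hom
  id := idHom
  comp := compHom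
  id_comp {a b} f := by
    cases a <;> cases b
    · exact Category.id_comp (obj := SimplexCategory) f
    · exact Category.id_comp (obj := SimplexCategory) f
    · exact f.elim
    · rfl
  comp_id {a b} f := by
    cases a <;> cases b
    · exact Category.comp_id (obj := SimplexCategory) f
    · rfl
    · exact f.elim
    · rfl
  assoc {a b c d} f g h := by
    cases a
    · cases b
      · cases c
        · cases d
          · exact Category.assoc (obj := SimplexCategory) f g h
          · exact Category.assoc (obj := SimplexCategory) f g h
        · cases d
          · exact h.elim
          · rfl
      · cases c
        · exact g.elim
        · cases d
          · exact h.elim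
          · rfl
    · cases b
      · exact f.elim
      · cases c
        · exact g.elim
        · cases d
          · exact h.elim
          · rfl

/-- The inclusion of the simplex category. -/
def incl : SimplexCategory ⥤ EpsCat where
  obj := simplex
  map f := f
  map_id _ := rfl
  map_comp _ _ := rfl

/-- The generating arrow `[1] ⟶ [ε]`. -/
def arrow : incl.obj (SimplexCategory.mk 1) ⟶ eps := 𝟙 (SimplexCategory.mk 1)

end EpsCat

/-- `ε`-simplicial sets: presheaves of sets on the category `EpsCat`. The elements of `X(ε)` are
the witnesses of `X`. -/
abbrev EpsSSet : Type 1 := EpsCatᵒᵖ ⥤ Type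

namespace EpsSSet

/-- The underlying simplicial set. -/
abbrev underlying (X : EpsSSet) : SSet.{0} := EpsCat.incl.op ⋙ X

/-- The `ε`-simplicial set given by a simplicial set `X`, a set `W` of witnesses and the map
`w : W → X₁` sending a witness to its `ε`-edge. -/
def ofMarking (X : SSet.{0}) (W : Type) (w : W → X.obj (op (SimplexCategory.mk 1))) : EpsSSet where
  obj U := match U with
    | ⟨.simplex n⟩ => X.obj (op n)
    | ⟨.eps⟩ => W
  map {U V} f := match U, V, f with
    | ⟨.simplex _⟩, ⟨.simplex _⟩, f => X.map (Quiver.Hom.op (V := SimplexCategory) f.unop)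
    | ⟨.eps⟩, ⟨.simplex _⟩, f =>
      ↾fun s => X.map (Quiver.Hom.op (V := SimplexCategory) f.unop) (w s)
    | ⟨.eps⟩, ⟨.eps⟩, _ => 𝟙 W
    | ⟨.simplex _⟩, ⟨.eps⟩, f => Empty.elim f.unop
  map_id U := by
    obtain ⟨_ | _⟩ := U
    · exact X.map_id _
    · rfl
  map_comp {U V T} f g := by
    obtain ⟨u | _⟩ := U
    · obtain ⟨v | _⟩ := V
      · obtain ⟨t | _⟩ := T
        · exact X.map_comp _ _
        · exact Empty.elim g.unop
      · exact Empty.elim f.unop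
    · obtain ⟨v | _⟩ := V
      · obtain ⟨t | _⟩ := T
        · ext s
          exact congrArg (fun h => h (w s)) (X.map_comp
            (Quiver.Hom.op (V := SimplexCategory) f.unop)
            (Quiver.Hom.op (V := SimplexCategory) g.unop))
        · exact Empty.elim g.unop
      · obtain ⟨t | _⟩ := T
        · rfl
        · rfl

/-- The sub-`ε`-simplicial set with underlying subcomplex `A` which contains a witness if and only
if its `ε`-edge belongs to `A`. -/
def markedSub {X : SSet.{0}} {W : Type} (w : W → X.obj (op (SimplexCategory.mk 1)))
    (A : X.Subcomplex) : Subfunctor (ofMarking X W w) where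
  obj U := match U with
    | ⟨.simplex n⟩ => A.obj (op n)
    | ⟨.eps⟩ => w ⁻¹' A.obj (op (SimplexCategory.mk 1))
  map {U V} f := match U, V, f with
    | ⟨.simplex _⟩, ⟨.simplex _⟩, f => A.map (Quiver.Hom.op (V := SimplexCategory) f.unop)
    | ⟨.eps⟩, ⟨.simplex _⟩, f =>
      fun _ hs => A.map (Quiver.Hom.op (V := SimplexCategory) f.unop) hs
    | ⟨.eps⟩, ⟨.eps⟩, _ => fun _ hs => hs
    | ⟨.simplex _⟩, ⟨.eps⟩, f => Empty.elim f.unop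

/-- A map of simplicial sets `S ⟶ underlying X`, regarded as a map from `S` without witnesses. -/
def fromUnmarked {S : SSet.{0}} {X : EpsSSet} (f : S ⟶ underlying X) :
    ofMarking S Empty Empty.elim ⟶ X where
  app U := match U with
    | ⟨.simplex n⟩ => f.app (op n)
    | ⟨.eps⟩ => ↾fun s => Empty.elim s
  naturality {U V} g := by
    obtain ⟨u | _⟩ := U
    · obtain ⟨v | _⟩ := V
      · exact f.naturality (Quiver.Hom.op (V := SimplexCategory) g.unop)
      · exact Empty.elim g.unop
    · ext s
      exact Empty.elim s

/-- Simplicial sets regarded as `ε`-simplicial sets without witnesses. -/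
def unmarked : SSet.{0} ⥤ EpsSSet where
  obj S := ofMarking S Empty Empty.elim
  map {S T} f := fromUnmarked (X := ofMarking T Empty Empty.elim)
    { app := fun n => f.app n, naturality := fun _ _ g => f.naturality g }
  map_id S := by
    ext U s
    obtain ⟨_ | _⟩ := U
    · rfl
    · exact Empty.elim s
  map_comp f g := by
    ext U s
    obtain ⟨_ | _⟩ := U
    · rfl
    · exact Empty.elim s

/-- `Sim^n`: the standard `n`-simplex with one witness, whose `ε`-edge is the edge from the first
to the last vertex. -/
def sim (n : ℕ) : EpsSSet :=
  ofMarking (SSet.stdSimplex.obj (SimplexCategory.mk n)) Unit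
    (fun _ => SSet.stdSimplex.edge n 0 (Fin.last n) (Fin.zero_le _))

/-- The face `∂ᵢ Sim^n` opposite to the vertex `i`; it contains the `ε`-edge if and only if it
contains the vertices `0` and `n`. -/
def simFace (n : ℕ) (i : Fin (n + 1)) : Subfunctor (sim n) :=
  markedSub _ (SSet.stdSimplex.face {i}ᶜ)

/-- The `ε`-horn: the union of the faces `∂ⱼ Sim^n` with `j ≠ i` (used for `i = 0` and `i = n`). -/
def epsHorn (n : ℕ) (i : Fin (n + 1)) : Subfunctor (sim n) :=
  ⨆ (j : Fin (n + 1)) (_ : j ≠ i), simFace n j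

/-- The inclusion `sk₀ X ⟶ X` of the vertices (with their degeneracies and no witnesses).
In Mathlib `skeleton 1` is generated by the simplices of dimension `< 1`. -/
def skZeroIncl (X : EpsSSet) :
    unmarked.obj ((underlying X).skeleton 1).toSSet ⟶ X :=
  fromUnmarked ((underlying X).skeleton 1).ι

/-- The map `sk₀ X ⟶ Δ^0`. -/
def skZeroToPoint (X : EpsSSet) :
    unmarked.obj ((underlying X).skeleton 1).toSSet ⟶
      unmarked.obj (SSet.stdSimplex.obj (SimplexCategory.mk 0)) :=
  unmarked.map (SSet.stdSimplex.isTerminalObj₀.from _)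

/-- The reduction of `X`: all the vertices of `X` are identified. -/
noncomputable def red (X : EpsSSet) : EpsSSet :=
  pushout (skZeroIncl X) (skZeroToPoint X)

/-- The quotient map onto the reduction. -/
noncomputable def toRed (X : EpsSSet) : X ⟶ red X :=
  pushout.inl (skZeroIncl X) (skZeroToPoint X)

/-- The cylinder `Δ^1 × (Δ^1)_red`. The factor `Δ^1` is drawn vertically and the loop `(Δ^1)_red`
horizontally: the cylinder is a square whose left and right vertical sides are identified. -/
noncomputable def cylinder : EpsSSet :=
  unmarked.obj (SSet.stdSimplex.obj (SimplexCategory.mk 1)) ⊗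
    red (unmarked.obj (SSet.stdSimplex.obj (SimplexCategory.mk 1)))

/-- For `i : Fin 2`, the `2`-simplex of the cylinder with vertical coordinate the degeneracy
`σᵢ : [2] ⟶ [1]` and horizontal coordinate the degeneracy `σⱼ : [2] ⟶ [1]`. -/
noncomputable def cylinderTriangle (i j : Fin 2) :
    unmarked.obj (SSet.stdSimplex.obj (SimplexCategory.mk 2)) ⟶ cylinder :=
  CartesianMonoidalCategory.lift
    (unmarked.map (SSet.stdSimplex.map (SimplexCategory.σ (n := 1) i)))
    (unmarked.map (SSet.stdSimplex.map (SimplexCategory.σ (n := 1) j)) ≫ toRed _)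

/-- The part of the cylinder generated by the lower triangle `(0,0), (0,1), (1,1)` (in coordinates
(vertical, horizontal)): it contains the bottom loop, the vertical edge, the diagonal and the lower
triangle, but neither the top loop nor the upper triangle. -/
noncomputable def lowerTriangle : Subfunctor cylinder :=
  Subfunctor.range (cylinderTriangle 0 1)

/-- The part of the cylinder generated by the upper triangle `(0,0), (1,0), (1,1)`: it contains the
top loop, the vertical edge, the diagonal and the upper triangle, but neither the bottom loop nor
the lower triangle. -/
noncomputable def upperTriangle : Subfunctor cylinder :=
  Subfunctor.range (cylinderTriangle 1 0)

/-- The two braiding inclusions: a map from `lowerTriangle` is a relation `c = b ∘ a₁` with a loop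
`a₁` at the source of `b`, and an extension to the cylinder is a loop `a₂` at the target of `b` with
`c = a₂ ∘ b`; and vice versa for `upperTriangle`. -/
inductive braiding : MorphismProperty EpsSSet
  | lower : braiding lowerTriangle.ι
  | upper : braiding upperTriangle.ι

/-- The `ε`-horns, the cells `∂Δ^n ⊂ Δ^n` for `n ≥ 3`, the associativity inclusion
`∂₀Δ^3 ∪ ∂₂Δ^3 ⊂ Δ^3`, and all the horns `Λ^n_i ⊂ Δ^n` for `n ≥ 3`. -/
inductive basicGenerators : MorphismProperty EpsSSet
  | epsHornFirst (n : ℕ) (hn : 1 ≤ n) : basicGenerators (epsHorn n 0).ι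
  | epsHornLast (n : ℕ) (hn : 1 ≤ n) : basicGenerators (epsHorn n (Fin.last n)).ι
  | cell (n : ℕ) (hn : 3 ≤ n) : basicGenerators (unmarked.map (SSet.boundary n).ι)
  | assoc : basicGenerators
      (unmarked.map (SSet.stdSimplex.face {0}ᶜ ⊔ SSet.stdSimplex.face {2}ᶜ :
        (SSet.stdSimplex.obj (SimplexCategory.mk 3)).Subcomplex).ι)
  | horn (n : ℕ) (hn : 3 ≤ n) (i : Fin (n + 1)) : basicGenerators (unmarked.map (SSet.horn n i).ι)

end EpsSSet

/-- A class of morphisms is weakly saturated if it is closed under pushouts, retracts and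
transfinite compositions. -/
structure IsWeaklySaturated {C : Type 1} [Category.{0} C] (W : MorphismProperty C) : Prop where
  pushouts : W.IsStableUnderCobaseChange
  retracts : W.IsStableUnderRetracts
  transfinite : MorphismProperty.IsStableUnderTransfiniteComposition.{0} W

/-- The weakly saturated class generated by `K`: the smallest weakly saturated class
containing `K`. -/
def weakSaturation {C : Type 1} [Category.{0} C] (K : MorphismProperty C) : MorphismProperty C :=
  sInf {W | IsWeaklySaturated W ∧ K ≤ W}

namespace EpsSSet

/-- The class `L₁`. -/
def classOne : MorphismProperty EpsSSet := weakSaturation basicGenerators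

/-- The class `L₂`, generated by `L₁` and the braiding inclusions. -/
def classTwo : MorphismProperty EpsSSet := weakSaturation (classOne ⊔ braiding)

end EpsSSet

/-! Write `Y` for the loop `red (sim 1)`. Multiplying by the initial object gives the initial
object, so the pushout-product of `f` with `∅ → Y` is `f ▷ Y` up to isomorphism
(`pushoutProduct_initial_mem`). The functor `- ⊗ Y` preserves colimits, so the morphisms that it
sends into a weakly saturated class form a weakly saturated class
(`IsWeaklySaturated.inverseImage`). It therefore suffices to treat the generators `A ⊂ B`, that is,
to build `B × Y` from `A × Y` by permitted attachments.

In most cases there are three stages. First, the graph of a map `B ⟶ Y` may be attached: it meets `A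
× Y` exactly over `A`, so this is a pushout of the generator `A ⊂ B` itself. A second graph may
follow if the two maps agree only on `A` (`extends_graph_graph`). Graphs are needed only for the
low-dimensional generators and the braidings. Once all witnesses are present, the question concerns
simplicial sets only (`ι_mem_of_under`). Second, the missing 2-simplices are reached one at a time,
each as the last face of a 3-simplex whose other faces are available; this uses the horns of
dimension 3, outer ones included. Third, once the 2-skeleton is present, the cells `∂Δ^n ⊂ Δ^n` with
`n ≥ 3` supply the rest (`SSet.ι_mem_of_fill`). The second stage is finite combinatorics of chains
in a product of linear orders, checked by `decide`. It repeatedly uses that `Y` has one vertex: a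
simplex with constant loop coordinate does not depend on the value of that coordinate.

The `ε`-horns of dimension 1 are the exception. Their product with `Y` is two-dimensional: after the
diagonal, which carries the only witness, its two triangles are attached along 2-dimensional
`ε`-horns (`epsHorn_one_whiskerRight_mem`). -/

namespace CategoryTheory.Subfunctor

/-! ### Attaching a cell to a subfunctor. -/

variable {C : Type*} [Category C] {F G : C ⥤ Type}

/-- Attaching the image of `σ` to a subfunctor `A` is a pushout along the inclusion of the preimage
of `A`, as soon as `σ` is injective outside of this preimage. -/
lemma isPushout_sup_range (A : Subfunctor F) (σ : G ⟶ F)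
    (hσ : ∀ U (x y : G.obj U), σ.app U x ∉ A.obj U → σ.app U y ∉ A.obj U →
      σ.app U x = σ.app U y → x = y) :
    IsPushout (A.fromPreimage σ) (A.preimage σ).ι
      (homOfLe (le_sup_left : A ≤ A ⊔ range σ)) (lift σ le_sup_right) where
  w := rfl
  isColimit' := ⟨evaluationJointlyReflectsColimits _ (fun U ↦ by
    refine (isColimitMapCoconePushoutCoconeEquiv _ _).2 (IsPushout.isColimit ?_)
    have : Mono ((homOfLe (le_sup_left : A ≤ A ⊔ range σ)).app U) := by
      rw [mono_iff_injective]
      rintro ⟨x, hx⟩ ⟨y, hy⟩ h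
      have h' : x = y := congrArg Subtype.val h
      exact Subtype.ext h'
    refine Types.isPushout_of_isPullback_of_mono' ?_ ?_ ?_
    · refine (Types.isPullback_iff _ _ _ _).2 ⟨rfl, ?_, ?_⟩
      · rintro ⟨x, hx⟩ ⟨y, hy⟩ ⟨_, h⟩
        exact Subtype.ext h
      · rintro ⟨x, hx⟩ y h
        have h' : x = σ.app U y := congrArg Subtype.val h
        subst h'
        exact ⟨⟨y, hx⟩, rfl, rfl⟩
    · refine Set.eq_univ_of_forall ?_
      rintro ⟨x, hx | ⟨y, rfl⟩⟩
      · exact Or.inl ⟨⟨x, hx⟩, rfl⟩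
      · exact Or.inr ⟨y, rfl⟩
    · intro x y hx hy h
      have h' : σ.app U x = σ.app U y := congrArg Subtype.val h
      exact hσ U x y (fun h ↦ hx ⟨⟨x, h⟩, rfl⟩) (fun h ↦ hy ⟨⟨y, h⟩, rfl⟩) h')⟩

end CategoryTheory.Subfunctor

/-! ### Weakly saturated classes. -/

section WeakSaturation

variable {C : Type 1} [Category.{0} C] {D : Type 1} [Category.{0} D]

lemma le_weakSaturation (K : MorphismProperty C) : K ≤ weakSaturation K :=
  le_sInf fun _ h ↦ h.2

lemma weakSaturation_le {K W : MorphismProperty C} (hW : IsWeaklySaturated W) (h : K ≤ W) :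
    weakSaturation K ≤ W :=
  sInf_le ⟨hW, h⟩

lemma weakSaturation_iff {K : MorphismProperty C} {X Y : C} (f : X ⟶ Y) :
    weakSaturation K f ↔ ∀ W : MorphismProperty C, IsWeaklySaturated W → K ≤ W → W f := by
  simp only [weakSaturation, MorphismProperty.sInf_iff]
  exact ⟨fun h W h₁ h₂ ↦ h W ⟨h₁, h₂⟩, fun h W hW ↦ h W hW.1 hW.2⟩

lemma isWeaklySaturated_weakSaturation (K : MorphismProperty C) :
    IsWeaklySaturated (weakSaturation K) where
  pushouts := ⟨fun sq hf ↦ (weakSaturation_iff _).2 fun W hW hK ↦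
    hW.pushouts.of_isPushout sq ((weakSaturation_iff _).1 hf W hW hK)⟩
  retracts := ⟨fun r hf ↦ (weakSaturation_iff _).2 fun W hW hK ↦
    hW.retracts.of_retract r ((weakSaturation_iff _).1 hf W hW hK)⟩
  transfinite :=
    have aux (J : Type) [LinearOrder J] [SuccOrder J] [OrderBot J] [WellFoundedLT J] :
        (weakSaturation K).IsStableUnderTransfiniteCompositionOfShape J :=
      ⟨fun _ _ _ ⟨hf⟩ ↦ (weakSaturation_iff _).2 fun W hW hK ↦
        have := hW.transfinite
        W.transfiniteCompositionsOfShape_le J _ ⟨hf.ofLE (weakSaturation_le hW hK)⟩⟩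
    { isStableUnderTransfiniteCompositionOfShape := fun J _ _ _ _ ↦ aux J }

namespace IsWeaklySaturated

variable {W : MorphismProperty C} (hW : IsWeaklySaturated W)
include hW

/-- A colimit-preserving functor carries pushouts, retracts and transfinite compositions to the
same. It is applied to `tensorRight`, which reduces the theorem to generators, and to `unmarked`,
which moves the filling arguments to simplicial sets. -/
lemma inverseImage (F : D ⥤ C) [PreservesColimits F] :
    IsWeaklySaturated (W.inverseImage F) :=
  have := hW.pushouts
  have := hW.retracts
  have := hW.transfinite
  { pushouts := ⟨fun sq hf ↦ hW.pushouts.of_isPushout (sq.map F) hf⟩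
    retracts := ⟨fun r hf ↦ hW.retracts.of_retract (r.map F) hf⟩
    transfinite :=
      have aux (J : Type) [LinearOrder J] [SuccOrder J] [OrderBot J] [WellFoundedLT J] :
          (W.inverseImage F).IsStableUnderTransfiniteCompositionOfShape J :=
        have : PreservesWellOrderContinuousOfShape J F := ⟨fun _ _ ↦ inferInstance⟩
        ⟨fun _ _ _ ⟨hf⟩ ↦ W.transfiniteCompositionsOfShape_le J _ ⟨hf.map⟩⟩
      { isStableUnderTransfiniteCompositionOfShape := fun J _ _ _ _ ↦ aux J } }

lemma respectsIso : W.RespectsIso :=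
  have := hW.retracts
  inferInstance

lemma comp {X Y Z : C} {f : X ⟶ Y} {g : Y ⟶ Z} (hf : W f) (hg : W g) : W (f ≫ g) :=
  have := hW.transfinite
  W.comp_mem _ _ hf hg

lemma of_isIso {X Y : C} (f : X ⟶ Y) [IsIso f] : W f :=
  have := hW.respectsIso
  have := hW.transfinite
  W.of_isIso f

lemma of_iso_comp {X Y Z : C} {f : X ⟶ Y} {g : Y ⟶ Z} [IsIso f] (h : W (f ≫ g)) : W g :=
  have := hW.respectsIso
  (W.cancel_left_of_respectsIso f g).1 h

end IsWeaklySaturated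

end WeakSaturation

/-! ### Extensions of subfunctors that lie in a weakly saturated class. -/

namespace CategoryTheory.Subfunctor

variable {D : Type} [Category.{0} D] {F G : D ⥤ Type}

/-- The inclusion of a subfunctor `A` into a larger one `A'` belongs to the class `W`. -/
def Extends (W : MorphismProperty (D ⥤ Type)) (A A' : Subfunctor F) : Prop :=
  ∃ h : A ≤ A', W (homOfLe h)

variable {W : MorphismProperty (D ⥤ Type)} (hW : IsWeaklySaturated W)

namespace Extends

lemma le {A A' : Subfunctor F} (h : Extends W A A') : A ≤ A' := h.1

include hW

lemma refl (A : Subfunctor F) : Extends W A A :=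
  ⟨le_rfl, hW.of_isIso (𝟙 A.toFunctor)⟩

lemma trans {A A' A'' : Subfunctor F} (h : Extends W A A') (h' : Extends W A' A'') :
    Extends W A A'' :=
  ⟨h.1.trans h'.1, hW.comp h.2 h'.2⟩

lemma ι_mem {A A' : Subfunctor F} (h : Extends W A A') (h' : W A'.ι) : W A.ι :=
  hW.comp h.2 h'

/-- The basic move of the proof: a cobase change of the preimage inclusion. Injectivity of `σ` is
required only outside that preimage, so a cell may have part of its boundary collapsed. -/
lemma sup_range (A : Subfunctor F) (σ : G ⟶ F)
    (hσ : ∀ U (x y : G.obj U), σ.app U x ∉ A.obj U → σ.app U y ∉ A.obj U →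
      σ.app U x = σ.app U y → x = y) (h : W (A.preimage σ).ι) :
    Extends W A (A ⊔ range σ) :=
  ⟨le_sup_left, hW.pushouts.of_isPushout (isPushout_sup_range A σ hσ).flip.flip h⟩

end Extends

include hW

lemma ι_mem_of_extends_top {A : Subfunctor F} (h : Extends W A ⊤) : W A.ι :=
  h.ι_mem hW (hW.of_isIso _)

lemma range_ι_mem_iff (f : G ⟶ F) [Mono f] : W (range f).ι ↔ W f := by
  have := hW.respectsIso
  rw [← W.cancel_left_of_respectsIso (toRange f) (range f).ι]
  rfl

/-- If `A` contains the image of the part of `F` on which `σ` is not surjective, the inclusion of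
`A` is a pushout of the inclusion of its preimage. -/
lemma ι_mem_of_preimage (A : Subfunctor F) (σ : G ⟶ F)
    (hσ : ∀ U, Function.Injective (σ.app U)) (hA : A ⊔ range σ = ⊤)
    (h : W (A.preimage σ).ι) : W A.ι :=
  ι_mem_of_extends_top hW (hA ▸ Extends.sup_range hW A σ (fun U _ _ _ _ h ↦ hσ U h) h)

end CategoryTheory.Subfunctor

/-! ### Attaching one simplex along its boundary or along a horn. -/

namespace SSet

open Simplicial

variable {B : SSet.{0}}

lemma boundary_le_preimage {n : ℕ} (A : B.Subcomplex) (σ : B _⦋n + 1⦌)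
    (h : ∀ j, B.δ j σ ∈ A.obj _) :
    boundary (n + 1) ≤ Subfunctor.preimage A (yonedaEquiv.symm σ) := by
  rw [boundary_eq_iSup, iSup_le_iff]
  intro j
  rw [stdSimplex.face_singleton_compl, Subcomplex.ofSimplex_le_iff]
  exact h j

lemma horn_le_preimage {n : ℕ} (A : B.Subcomplex) (σ : B _⦋n + 1⦌) (i : Fin (n + 2))
    (h : ∀ j ≠ i, B.δ j σ ∈ A.obj _) :
    horn (n + 1) i ≤ Subfunctor.preimage A (yonedaEquiv.symm σ) := by
  rw [horn_eq_iSup, iSup_le_iff]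
  intro j
  rw [stdSimplex.face_singleton_compl, Subcomplex.ofSimplex_le_iff]
  exact h j.1 j.2

lemma epi_of_notMem_boundary {n : ℕ} {m : SimplexCategory} (f : m ⟶ ⦋n⦌)
    (hf : stdSimplex.objEquiv.symm f ∉ (boundary.{0} n).obj (op m)) : Epi f := by
  simpa [SimplexCategory.epi_iff_surjective, boundary] using! hf

/-- A simplex outside of a horn is a degeneracy of the whole simplex or of the missing face. -/
lemma epi_or_of_notMem_horn {n : ℕ} {m : SimplexCategory} (f : m ⟶ ⦋n + 1⦌) (i : Fin (n + 2))
    (hf : stdSimplex.objEquiv.symm f ∉ (horn.{0} (n + 1) i).obj (op m)) :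
    Epi f ∨ ∃ g : m ⟶ ⦋n⦌, Epi g ∧ f = g ≫ SimplexCategory.δ i := by
  rw [mem_horn_iff, not_not] at hf
  replace hf : ∀ j, j ≠ i → ∃ k, f.toOrderHom k = j := fun j hj ↦ by
    have h := Set.mem_univ j
    rw [← hf] at h
    exact h.resolve_right hj
  by_cases h : ∃ k, f.toOrderHom k = i
  · refine Or.inl ?_
    rw [SimplexCategory.epi_iff_surjective]
    intro j
    by_cases hj : j = i
    · exact hj ▸ h
    · exact hf j hj
  · push Not at h
    obtain ⟨m⟩ := m
    obtain ⟨g, rfl⟩ := SimplexCategory.eq_comp_δ_of_not_surjective' f i h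
    refine Or.inr ⟨g, ?_, rfl⟩
    rw [SimplexCategory.epi_iff_surjective]
    intro j
    obtain ⟨k, hk⟩ := hf (i.succAbove j) (Fin.succAbove_ne i j)
    exact ⟨k, Fin.succAbove_right_injective hk⟩

variable {W : MorphismProperty SSet.{0}} (hW : IsWeaklySaturated W)

include hW

/-- Attaching a simplex whose boundary already belongs to the subcomplex. -/
lemma extends_cell {n : ℕ} (hn : W (boundary (n + 1)).ι) (A : B.Subcomplex) (σ : B _⦋n + 1⦌)
    (h : ∀ m ≤ n, ∀ x : B _⦋m⦌, x ∈ A.obj _) :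
    ∃ A' : B.Subcomplex, Subfunctor.Extends W A A' ∧ σ ∈ A'.obj _ := by
  by_cases hσ : σ ∈ A.obj _
  · exact ⟨A, .refl hW A, hσ⟩
  -- A degenerate `σ` comes from a lower dimension, where `A` already contains everything.
  have hσ' : σ ∈ B.nonDegenerate (n + 1) := by
    rintro ⟨m, hm, f, y, rfl⟩
    exact hσ (A.map _ (h m (by lia) y))
  have hpre : Subfunctor.preimage A (yonedaEquiv.symm σ) = boundary (n + 1) := by
    rw [stdSimplex.eq_boundary_iff]
    refine ⟨boundary_le_preimage A σ fun j ↦ h n le_rfl _, fun h' ↦ hσ ?_⟩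
    have := h'.ge _ (show stdSimplex.objEquiv.symm (𝟙 ⦋n + 1⦌) ∈ _ from Set.mem_univ _)
    simpa using! this
  refine ⟨_, Subfunctor.Extends.sup_range hW A (yonedaEquiv.symm σ) ?_ (by rwa [hpre]), ?_⟩
  -- Outside the boundary only degeneracies of the top simplex remain, and the degeneracy operator
  -- over a nondegenerate simplex is unique.
  · rintro ⟨⟨m⟩⟩ x y hx hy hxy
    obtain ⟨f, rfl⟩ := stdSimplex.objEquiv.symm.surjective x
    obtain ⟨g, rfl⟩ := stdSimplex.objEquiv.symm.surjective y
    have := epi_of_notMem_boundary f (fun h ↦ hx (hpre.ge _ h))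
    exact congrArg _ (B.unique_nonDegenerate_map _ f ⟨σ, hσ'⟩ rfl g ⟨σ, hσ'⟩ hxy)
  · exact Or.inr ⟨stdSimplex.objEquiv.symm (𝟙 _), by simp⟩

/-- Attaching a simplex all of whose faces but one belong to the subcomplex. -/
lemma extends_horn {n : ℕ} (i : Fin (n + 3)) (hn : W (horn (n + 2) i).ι) (A : B.Subcomplex)
    (σ : B _⦋n + 2⦌) (h : ∀ j ≠ i, B.δ j σ ∈ A.obj _) :
    ∃ A' : B.Subcomplex, Subfunctor.Extends W A A' ∧ B.δ i σ ∈ A'.obj _ := by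
  by_cases hi : B.δ i σ ∈ A.obj _
  · exact ⟨A, .refl hW A, hi⟩
  have hpre : Subfunctor.preimage A (yonedaEquiv.symm σ) = horn (n + 2) i := by
    refine le_antisymm ?_ (horn_le_preimage A σ i h)
    rw [subcomplex_le_horn_iff, stdSimplex.face_singleton_compl, Subcomplex.ofSimplex_le_iff]
    exact hi
  -- If the missing face were a degeneracy of `y`, then `y` would be one of its own faces. That face
  -- has codimension two in `σ`, hence lies in the horn and in `A`.
  have hface : B.δ i σ ∈ B.nonDegenerate (n + 1) := by
    rw [mem_nonDegenerate_iff_notMem_degenerate, degenerate_eq_iUnion_range_σ, Set.mem_iUnion]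
    rintro ⟨k, y, hy⟩
    have hy' : B.δ k.castSucc (B.δ i σ) ∈ A.obj _ := by
      have : stdSimplex.objEquiv.symm (SimplexCategory.δ k.castSucc ≫ SimplexCategory.δ i) ∈
          (horn.{0} (n + 2) i).obj _ := by simp [horn_obj_eq_univ i n]
      have := horn_le_preimage A σ i h _ this
      change B.map (SimplexCategory.δ k.castSucc ≫ SimplexCategory.δ i).op σ ∈ A.obj _ at this
      rwa [op_comp, Functor.map_comp] at this
    rw [← hy, δ_comp_σ_self_apply] at hy'
    exact hi (hy ▸ A.map _ hy')
  -- A degeneracy of `y` has `y` as two adjacent faces. One of them is not the missing face, so `y`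
  -- would belong to `A`.
  have hσ : σ ∈ B.nonDegenerate (n + 2) := by
    rw [mem_nonDegenerate_iff_notMem_degenerate, degenerate_eq_iUnion_range_σ, Set.mem_iUnion]
    rintro ⟨k, y, rfl⟩
    have hy : y ∈ A.obj _ := by
      by_cases hk : k.castSucc = i
      · have := h k.succ (by rw [← hk]; exact (Fin.castSucc_lt_succ).ne')
        rwa [δ_comp_σ_succ_apply] at this
      · have := h _ hk
        rwa [δ_comp_σ_self_apply] at this
    exact hi (A.map _ (A.map _ hy))
  refine ⟨_, Subfunctor.Extends.sup_range hW A (yonedaEquiv.symm σ) ?_ (by rwa [hpre]), ?_⟩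
  -- Outside the horn there are only degeneracies of `σ` and of its missing face. Both are
  -- nondegenerate and their dimensions differ, so uniqueness of the nondegenerate core excludes the
  -- mixed cases.
  · rintro ⟨⟨m⟩⟩ x y hx hy hxy
    obtain ⟨f, rfl⟩ := stdSimplex.objEquiv.symm.surjective x
    obtain ⟨g, rfl⟩ := stdSimplex.objEquiv.symm.surjective y
    replace hxy : B.map f.op σ = B.map g.op σ := hxy
    have aux (f : SimplexCategory.mk m ⟶ ⦋n + 1⦌) :
        B.map (f ≫ SimplexCategory.δ i).op σ = B.map f.op (B.δ i σ) := by
      rw [op_comp, Functor.map_comp]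
      rfl
    refine congrArg _ ?_
    obtain hf | ⟨f, hf, rfl⟩ := epi_or_of_notMem_horn f i (fun h ↦ hx (hpre.ge _ h)) <;>
    obtain hg | ⟨g, hg, rfl⟩ := epi_or_of_notMem_horn g i (fun h ↦ hy (hpre.ge _ h))
    · exact B.unique_nonDegenerate_map _ f ⟨σ, hσ⟩ rfl g ⟨σ, hσ⟩ hxy
    · have := B.unique_nonDegenerate_dim _ f ⟨σ, hσ⟩ rfl g ⟨_, hface⟩ (hxy.trans (aux g))
      lia
    · have := B.unique_nonDegenerate_dim _ g ⟨σ, hσ⟩ rfl f ⟨_, hface⟩ (hxy.symm.trans (aux f))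
      lia
    · rw [aux, aux] at hxy
      rw [B.unique_nonDegenerate_map _ f ⟨_, hface⟩ rfl g ⟨_, hface⟩ hxy]
  · exact Or.inr ⟨stdSimplex.objEquiv.symm (SimplexCategory.δ i), rfl⟩

end SSet

/-! ### Reaching all simplices by filling horns and attaching cells. -/

namespace SSet

variable {B : SSet.{0}}

/-- The `2`-simplices which are obtained from those of the subcomplex `A` by successively filling
horns in `3`-simplices. -/
inductive Fill (A : B.Subcomplex) : B.obj (op (.mk 2)) → Prop where
  | base (x : B.obj (op (.mk 2))) (h : x ∈ A.obj _) : Fill A x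
  | fill (σ : B.obj (op (.mk 3))) (i : Fin 4) (h : ∀ j ≠ i, Fill A (B.δ j σ)) : Fill A (B.δ i σ)

open Simplicial

variable {W : MorphismProperty SSet.{0}} (hW : IsWeaklySaturated W)

include hW

/-- The hypothesis speaks of every extension `A₁` of `A`, so the simplices can be attached one after
another without regard to what was attached before. -/
lemma exists_extends_of_finite {ι : Type*} [Finite ι] {n : ℕ} (x : ι → B _⦋n⦌) (A : B.Subcomplex)
    (h : ∀ i (A₁ : B.Subcomplex), Subfunctor.Extends W A A₁ →
      ∃ A₂ : B.Subcomplex, Subfunctor.Extends W A₁ A₂ ∧ x i ∈ A₂.obj _) :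
    ∃ A₂ : B.Subcomplex, Subfunctor.Extends W A A₂ ∧ ∀ i, x i ∈ A₂.obj _ := by
  classical
  have := Fintype.ofFinite ι
  suffices ∀ s : Finset ι, ∃ A₂ : B.Subcomplex, Subfunctor.Extends W A A₂ ∧
      ∀ i ∈ s, x i ∈ A₂.obj _ by
    obtain ⟨A₂, h₁, h₂⟩ := this Finset.univ
    exact ⟨A₂, h₁, fun i ↦ h₂ i (Finset.mem_univ i)⟩
  intro s
  induction s using Finset.induction with
  | empty => exact ⟨A, .refl hW A, by simp⟩
  | insert i s _ ih =>
    obtain ⟨A₁, h₁, h₁'⟩ := ih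
    obtain ⟨A₂, h₂, h₂'⟩ := h i A₁ h₁
    refine ⟨A₂, h₁.trans hW h₂, fun j hj ↦ ?_⟩
    obtain rfl | hj := Finset.mem_insert.1 hj
    · exact h₂'
    · exact h₂.le _ (h₁' j hj)

/-- Induction on the filling: the three given faces of a tetrahedron are attached successively, then
its horn is filled. The larger `A₁` must be arbitrary because the attachments for one face precede
those for the next. -/
lemma Fill.exists_extends (hhorn : ∀ i, W (SSet.horn 3 i).ι) {A : B.Subcomplex} {x : B _⦋2⦌}
    (hx : Fill A x) (A₁ : B.Subcomplex) (h₁ : A ≤ A₁) :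
    ∃ A₂ : B.Subcomplex, Subfunctor.Extends W A₁ A₂ ∧ x ∈ A₂.obj _ := by
  induction hx generalizing A₁ with
  | base _ h => exact ⟨A₁, .refl hW A₁, h₁ _ h⟩
  | fill σ i _ ih =>
    obtain ⟨A₂, h₂, h₂'⟩ := exists_extends_of_finite hW
      (fun j : {j : Fin 4 // j ≠ i} ↦ B.δ j.1 σ) A₁
      (fun j A₂ h₂ ↦ ih j.1 j.2 A₂ (h₁.trans h₂.le))
    obtain ⟨A₃, h₃, h₃'⟩ := extends_horn hW i (hhorn i) A₂ σ (fun j hj ↦ h₂' ⟨j, hj⟩)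
    exact ⟨A₃, h₂.trans hW h₃, h₃'⟩

/-- The inclusion of the first term of an exhaustive sequence of subcomplexes. -/
lemma ι_mem_of_sequence (A : ℕ → B.Subcomplex) (h : ∀ n, Subfunctor.Extends W (A n) (A (n + 1)))
    (hA : ⨆ n, A n = ⊤) : W (A 0).ι := by
  have := hW.transfinite
  have hmono : Monotone A := monotone_nat_of_le_succ fun n ↦ (h n).le
  let t : W.TransfiniteCompositionOfShape ℕ (A 0).ι :=
    { F := hmono.functor ⋙ Subcomplex.toSSetFunctor
      isoBot := Iso.refl _
      incl := { app := fun _ ↦ Subcomplex.ι _ }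
      isColimit :=
        IsColimit.ofIsoColimit (isColimitOfPreserves (Subcomplex.toSSetFunctor)
          ((CompleteLattice.colimitCocone hmono.functor).isColimit))
            (Cocone.ext (Subcomplex.eqToIso hA ≪≫ Subcomplex.topIso B))
      map_mem := fun n _ ↦ (h n).2 }
  exact W.transfiniteCompositionsOfShape_le ℕ _ ⟨t⟩

/-- Stage `n` attaches the finitely many simplices of dimension `n + 3`; the inclusion is the
countable composition of the stages. -/
lemma ι_mem_of_dim_le_two [∀ n, Finite (B _⦋n⦌)] (hcell : ∀ n ≥ 3, W (boundary n).ι)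
    (A : B.Subcomplex) (hA : ∀ m ≤ 2, ∀ x : B _⦋m⦌, x ∈ A.obj _) : W A.ι := by
  have step (n : ℕ) (A : {A : B.Subcomplex // ∀ m ≤ n + 2, ∀ x : B _⦋m⦌, x ∈ A.obj _}) :
      ∃ A' : {A : B.Subcomplex // ∀ m ≤ n + 1 + 2, ∀ x : B _⦋m⦌, x ∈ A.obj _},
        Subfunctor.Extends W A.1 A'.1 := by
    obtain ⟨A', h, h'⟩ := exists_extends_of_finite hW (fun x : B _⦋n + 2 + 1⦌ ↦ x) A.1
      (fun x A₁ h₁ ↦ extends_cell hW (hcell _ (by lia)) A₁ x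
        (fun m hm y ↦ h₁.le _ (A.2 m hm y)))
    refine ⟨⟨A', fun m hm x ↦ ?_⟩, h⟩
    obtain hm | rfl := Nat.lt_or_eq_of_le hm
    · exact h.le _ (A.2 m (by lia) x)
    · exact h' x
  choose next hnext using step
  let a (n : ℕ) : {A : B.Subcomplex // ∀ m ≤ n + 2, ∀ x : B _⦋m⦌, x ∈ A.obj _} :=
    Nat.rec ⟨A, hA⟩ next n
  refine ι_mem_of_sequence hW (fun n ↦ (a n).1) (fun n ↦ hnext n (a n)) ?_
  rw [← top_le_iff]
  rintro ⟨⟨n⟩⟩ x _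
  rw [Subfunctor.iSup_obj]
  exact Set.mem_iUnion.2 ⟨n, (a n).2 n (by lia) x⟩

/-- A subcomplex from which all the `2`-simplices can be reached by filling horns. -/
lemma ι_mem_of_fill [∀ n, Finite (B _⦋n⦌)] (hcell : ∀ n ≥ 3, W (boundary n).ι)
    (hhorn : ∀ i, W (SSet.horn 3 i).ι) (A : B.Subcomplex) (hA : ∀ x : B _⦋2⦌, Fill A x) :
    W A.ι := by
  obtain ⟨A', h, h'⟩ := exists_extends_of_finite hW (fun x : B _⦋2⦌ ↦ x) A
    (fun x A₁ h₁ ↦ (hA x).exists_extends hW hhorn A₁ h₁.le)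
  -- Simplices of dimension below 2 are faces of their own degeneracies.
  have h₁ (x : B _⦋1⦌) : x ∈ A'.obj _ := by
    rw [← δ_comp_σ_self_apply 0 x]
    exact A'.map _ (h' _)
  have h₀ (x : B _⦋0⦌) : x ∈ A'.obj _ := by
    rw [← δ_comp_σ_self_apply 0 x]
    exact A'.map _ (h₁ _)
  refine h.ι_mem hW (ι_mem_of_dim_le_two hW hcell A' fun m hm ↦ ?_)
  interval_cases m
  exacts [h₀, h₁, h']

end SSet

/-! ### Reduction to underlying simplicial sets, and attaching graphs. -/

namespace EpsSSet

/-- The functor sending an `ε`-simplicial set to its underlying simplicial set. -/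
abbrev underlyingFunctor : EpsSSet ⥤ SSet.{0} :=
  (Functor.whiskeringLeft _ _ _).obj EpsCat.incl.op

/-- Simplicial sets without witnesses are left adjoint to the underlying simplicial sets. -/
def unmarkedAdjunction : unmarked ⊣ underlyingFunctor :=
  Adjunction.mkOfHomEquiv
    { homEquiv S X :=
        { toFun f :=
            { app n := f.app (op (.simplex n.unop))
              naturality _ _ g := f.naturality (EpsCat.incl.op.map g) }
          invFun f := fromUnmarked f
          left_inv f := by
            ext U s
            obtain ⟨_ | _⟩ := U
            · rfl
            · exact Empty.elim s
          right_inv _ := rfl }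
      homEquiv_naturality_left_symm f g := by
        ext U s
        obtain ⟨_ | _⟩ := U
        · rfl
        · exact Empty.elim s
      homEquiv_naturality_right _ _ := rfl }

instance : PreservesColimits unmarked :=
  unmarkedAdjunction.leftAdjoint_preservesColimits

instance {S T : SSet.{0}} (f : S ⟶ T) [Mono f] : Mono (unmarked.map f) := by
  have (U : EpsCatᵒᵖ) : Mono ((unmarked.map f).app U) := by
    rw [mono_iff_injective]
    intro x y h
    obtain ⟨u | _⟩ := U
    · exact (mono_iff_injective (f.app (op u))).1 inferInstance h
    · exact Empty.elim x
  exact NatTrans.mono_of_mono_app _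

/-- The underlying subcomplex of a sub-`ε`-simplicial set. -/
def under {X : EpsSSet} (A : Subfunctor X) : (underlying X).Subcomplex where
  obj n := A.obj (op (.simplex n.unop))
  map g := A.map (EpsCat.incl.op.map g)

section

variable {W : MorphismProperty EpsSSet} (hW : IsWeaklySaturated W)

include hW

/-- A sub-`ε`-simplicial set containing all the witnesses is included by a pushout of the inclusion
of its underlying subcomplex. -/
lemma ι_mem_of_under {X : EpsSSet} (A : Subfunctor X)
    (hA : ∀ w : X.obj (op .eps), w ∈ A.obj _) (h : W (unmarked.map (under A).ι)) : W A.ι := by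
  refine Subfunctor.ι_mem_of_preimage hW A (fromUnmarked (𝟙 (underlying X))) ?_ ?_ ?_
  · rintro ⟨u | _⟩ x y h
    · exact h
    · exact Empty.elim x
  · rw [← top_le_iff]
    rintro ⟨u | _⟩ x _
    · exact Or.inr ⟨x, rfl⟩
    · exact Or.inl (hA x)
  · rw [← Subfunctor.range_ι_mem_iff hW] at h
    have : Subfunctor.preimage A (fromUnmarked (𝟙 (underlying X))) =
        Subfunctor.range (unmarked.map (under A).ι) := by
      ext U x
      obtain ⟨u | _⟩ := U
      · exact ⟨fun hx ↦ ⟨⟨x, hx⟩, rfl⟩, by rintro ⟨⟨y, hy⟩, rfl⟩; exact hy⟩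
      · exact Empty.elim x
    rwa [this]

/-- Replaces `A × Y` by a subfunctor of `B × Y`, to which cells can be attached. -/
lemma whiskerRight_mem {A B : EpsSSet} (f : A ⟶ B) [Mono f] (Y : EpsSSet)
    (h : W (Subfunctor.preimage (Subfunctor.range f)
      (CartesianMonoidalCategory.fst B Y)).ι) : W (f ▷ Y) := by
  have : Mono (f ▷ Y) := by
    have (U : EpsCatᵒᵖ) : Mono ((f ▷ Y).app U) := by
      rw [mono_iff_injective]
      rintro ⟨x, y⟩ ⟨x', y'⟩ h
      have h₁ : f.app U x = f.app U x' := congrArg Prod.fst h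
      have h₂ : y = y' := congrArg Prod.snd h
      rw [(mono_iff_injective (f.app U)).1 inferInstance h₁, h₂]
    exact NatTrans.mono_of_mono_app _
  rw [← Subfunctor.range_ι_mem_iff hW]
  have : Subfunctor.range (f ▷ Y) = Subfunctor.preimage (Subfunctor.range f)
      (CartesianMonoidalCategory.fst B Y) := by
    ext U ⟨x, y⟩
    exact ⟨fun ⟨⟨z, y'⟩, h⟩ ↦ ⟨z, congrArg Prod.fst h⟩,
      fun ⟨z, h⟩ ↦ ⟨⟨z, y⟩, Prod.ext h rfl⟩⟩
  rwa [this]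

/-- The graph of a morphism. -/
abbrev graph {B Y : EpsSSet} (t : B ⟶ Y) : B ⟶ B ⊗ Y :=
  CartesianMonoidalCategory.lift (𝟙 B) t

/-- A graph is injective by its first coordinate, so attaching it is a pushout of the inclusion of
its preimage, here `A`. -/
lemma extends_graph {B Y : EpsSSet} {A : Subfunctor B} (hA : W A.ι)
    (A' : Subfunctor (B ⊗ Y)) (t : B ⟶ Y) (h : Subfunctor.preimage A' (graph t) = A) :
    Subfunctor.Extends W A' (A' ⊔ Subfunctor.range (graph t)) :=
  .sup_range hW A' (graph t) (fun _ _ _ _ _ h ↦ congrArg Prod.fst h) (by rwa [h])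

lemma extends_graph_fst {B Y : EpsSSet} {A : Subfunctor B} (hA : W A.ι) (t : B ⟶ Y) :
    Subfunctor.Extends W (Subfunctor.preimage A (CartesianMonoidalCategory.fst B Y))
      (Subfunctor.preimage A (CartesianMonoidalCategory.fst B Y) ⊔
        Subfunctor.range (graph t)) :=
  extends_graph hW hA _ t rfl

/-- Two graphs meet over the locus where the maps agree. If it lies in `A`, the first graph does not
enlarge the preimage of `A × Y` under the second. -/
lemma extends_graph_graph {B Y : EpsSSet} {A : Subfunctor B} (hA : W A.ι) (t t' : B ⟶ Y)
    (h : ∀ U (b : B.obj U), t.app U b = t'.app U b → b ∈ A.obj U) :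
    Subfunctor.Extends W (Subfunctor.preimage A (CartesianMonoidalCategory.fst B Y))
      (Subfunctor.preimage A (CartesianMonoidalCategory.fst B Y) ⊔
        Subfunctor.range (graph t) ⊔ Subfunctor.range (graph t')) := by
  refine (extends_graph_fst hW hA t).trans hW (extends_graph hW hA _ t' ?_)
  refine le_antisymm (fun U b hb ↦ ?_) (fun U b hb ↦ Or.inl hb)
  obtain hb | ⟨b', hb⟩ := hb
  · exact hb
  · have h₁ : b' = b := congrArg Prod.fst hb
    have h₂ : t.app U b' = t'.app U b := congrArg Prod.snd hb
    subst h₁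
    exact h U b' h₂

end

/-! ### Simplices of the reduction. -/

lemma isPushout_red_app (X : EpsSSet) (U : EpsCatᵒᵖ) :
    IsPushout ((skZeroIncl X).app U) ((skZeroToPoint X).app U) ((toRed X).app U)
      ((pushout.inr (skZeroIncl X) (skZeroToPoint X)).app U) :=
  (IsPushout.of_hasPushout (skZeroIncl X) (skZeroToPoint X)).map ((evaluation _ _).obj U)

lemma stdSimplex_zero_subsingleton (m : SimplexCategory)
    (x y : (SSet.stdSimplex.{0}.obj (.mk 0)).obj (op m)) : x = y := by
  obtain ⟨m⟩ := m
  exact SSet.stdSimplex.ext _ _ fun i ↦ Subsingleton.elim (α := Fin 1) _ _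

/-- A vertex `v` is needed so that the simplices of the added point come from `X`; the point has no
witnesses. -/
lemma toRed_surjective (X : EpsSSet) (v : X.obj (op (.simplex (.mk 0)))) (U : EpsCatᵒᵖ) :
    Function.Surjective ((toRed X).app U) := by
  intro y
  obtain h | ⟨p, rfl⟩ := Types.eq_or_eq_of_isPushout (isPushout_red_app X U) y
  · exact h
  · obtain ⟨u | _⟩ := U
    · let s : ((underlying X).skeleton 1).obj (op u) :=
        ⟨(underlying X).map (SimplexCategory.const u (.mk 0) 0).op v,
          ((underlying X).skeleton 1).map _ ((underlying X).mem_skeleton v)⟩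
      refine ⟨s.1, ?_⟩
      refine (ConcreteCategory.congr_hom (isPushout_red_app X (op (.simplex u))).w s).trans ?_
      exact congrArg ((pushout.inr (skZeroIncl X) (skZeroToPoint X)).app (op (.simplex u)))
        (stdSimplex_zero_subsingleton _ _ _)
    · exact Empty.elim p

lemma toRed_app_eq_iff (X : EpsSSet) {m : SimplexCategory} (x y : X.obj (op (.simplex m))) :
    (toRed X).app _ x = (toRed X).app _ y ↔
      x = y ∨ x ∈ ((underlying X).skeleton 1).obj (op m) ∧
        y ∈ ((underlying X).skeleton 1).obj (op m) := by
  classical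
  have sq := isPushout_red_app X (op (.simplex m))
  constructor
  · intro h
    -- A function that collapses the 0-skeleton to `none` and is injective elsewhere factors through
    -- the pushout, hence detects equality there.
    let q : X.obj (op (.simplex m)) ⟶ Option (X.obj (op (.simplex m))) :=
      ↾fun x ↦ if x ∈ ((underlying X).skeleton 1).obj (op m) then none else some x
    obtain ⟨φ, hφ, -⟩ := sq.exists_desc q (↾fun _ ↦ none) (by
      exact ConcreteCategory.hom_ext _ _ fun s ↦ if_pos s.2)
    have hq : q x = q y := by
      rw [← hφ]
      exact congrArg φ h
    change (if _ then _ else _) = (if _ then _ else _) at hq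
    split_ifs at hq with hx hy hy
    · exact Or.inr ⟨hx, hy⟩
    · exact Or.inl (Option.some_injective _ hq)
  · rintro (rfl | ⟨hx, hy⟩)
    · rfl
    · refine (ConcreteCategory.congr_hom sq.w ⟨x, hx⟩).trans
        (Eq.trans ?_ (ConcreteCategory.congr_hom sq.w ⟨y, hy⟩).symm)
      exact congrArg ((pushout.inr (skZeroIncl X) (skZeroToPoint X)).app (op (.simplex m)))
        (stdSimplex_zero_subsingleton _ _ _)

end EpsSSet

/-- A simplex of the 0-skeleton is a degeneracy of a vertex: restricting along a section of its
degeneracy operator keeps its nondegenerate core in the skeleton, so this core has dimension 0. -/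
lemma SSet.mem_skeleton_one_stdSimplex_iff {n m : ℕ}
    (x : (SSet.stdSimplex.{0}.obj (.mk n)).obj (op (.mk m))) :
    x ∈ ((SSet.stdSimplex.obj (.mk n)).skeleton 1).obj (op (.mk m)) ↔ ∀ i j, x i = x j := by
  constructor
  · intro h i j
    obtain ⟨k, f, _, y, rfl⟩ := exists_nonDegenerate _ x
    have hy : y.1 ∈ ((SSet.stdSimplex.obj (.mk n)).skeleton 1).obj (op (.mk k)) := by
      have := isSplitEpi_of_epi f
      have := Subfunctor.map _ (section_ f).op h
      rwa [Set.mem_preimage, ← comp_apply, ← Functor.map_comp, ← op_comp,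
        IsSplitEpi.id, op_id, CategoryTheory.Functor.map_id, id_apply] at this
    obtain rfl : k = 0 := by
      rw [mem_skeleton_obj_iff_of_nonDegenerate] at hy
      lia
    exact congrArg y.1 (Subsingleton.elim (α := Fin 1) _ _)
  · intro h
    have : x = (SSet.stdSimplex.obj (.mk n)).map (SimplexCategory.const (.mk m) (.mk 0) 0).op
        (SSet.stdSimplex.obj₀Equiv.symm (x 0)) :=
      SSet.stdSimplex.ext _ _ fun i ↦ h i 0
    rw [this]
    exact Subfunctor.map _ _ (SSet.mem_skeleton _ _)

/-! ### Chains in a poset and horn filling in coordinates. -/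

section Chains

variable {P : Type} [PartialOrder P]

/-- The chain `p ≤ q ≤ r`, as a monotone map. -/
def chainThree (p q r : P) (h : p ≤ q) (h' : q ≤ r) : Fin 3 →o P :=
  ⟨![p, q, r], by
    rw [Fin.monotone_iff_le_succ]
    intro i
    fin_cases i
    exacts [h, h']⟩

/-- The chain `p ≤ q ≤ r ≤ s`, as a monotone map. -/
def chainFour (p q r s : P) (h : p ≤ q) (h' : q ≤ r) (h'' : r ≤ s) : Fin 4 →o P :=
  ⟨![p, q, r, s], by
    rw [Fin.monotone_iff_le_succ]
    intro i
    fin_cases i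
    exacts [h, h', h'']⟩

end Chains

namespace SSet

open Simplicial

/-- A family of simplices of `B`, parametrized by the chains of a partially ordered set `P` in a way
which is compatible with the faces, and containing all the simplices of `B`. -/
structure Chart (P : Type) [PartialOrder P] (B : SSet.{0}) where
  simplex {m : ℕ} : (Fin (m + 1) →o P) → B _⦋m⦌
  δ_simplex {m : ℕ} (g : Fin (m + 2) →o P) (j : Fin (m + 2)) :
    B.δ j (simplex g) = simplex (g.comp (Fin.succAboveOrderEmb j).toOrderHom)
  surjective (m : ℕ) : Function.Surjective (simplex (m := m))

namespace Chart

variable {P : Type} [PartialOrder P] {B : SSet.{0}} (c : Chart P B)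

include c in
lemma finite [Finite P] (n : ℕ) : Finite (B _⦋n⦌) :=
  have : Finite (Fin (n + 1) →o P) := Finite.of_injective _ DFunLike.coe_injective
  Finite.of_surjective _ (c.surjective n)

/-- The triangle `p ≤ q ≤ r` can be reached from `A` by filling horns. -/
def Fills (A : B.Subcomplex) (p q r : P) : Prop :=
  ∃ (h : p ≤ q) (h' : q ≤ r), Fill A (c.simplex (chainThree p q r h h'))

variable {c} {A : B.Subcomplex} {p q r s : P}

lemma δ_chainFour (h : p ≤ q) (h' : q ≤ r) (h'' : r ≤ s) :
    B.δ 0 (c.simplex (chainFour p q r s h h' h'')) = c.simplex (chainThree q r s h' h'') ∧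
    B.δ 1 (c.simplex (chainFour p q r s h h' h'')) =
      c.simplex (chainThree p r s (h.trans h') h'') ∧
    B.δ 2 (c.simplex (chainFour p q r s h h' h'')) =
      c.simplex (chainThree p q s h (h'.trans h'')) ∧
    B.δ 3 (c.simplex (chainFour p q r s h h' h'')) = c.simplex (chainThree p q r h h') := by
  refine ⟨?_, ?_, ?_, ?_⟩
  all_goals
    exact (c.δ_simplex _ _).trans
      (congrArg _ (OrderHom.ext _ _ (funext fun i ↦ by fin_cases i <;> rfl)))

/-- The four lemmas of this kind are the filling moves in the tetrahedron `p ≤ q ≤ r ≤ s`; the name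
records the face that is gained. -/
lemma Fills.face_zero (h₁ : c.Fills A p r s) (h₂ : c.Fills A p q s) (h₃ : c.Fills A p q r) :
    c.Fills A q r s := by
  obtain ⟨_, h'', h₁⟩ := h₁
  obtain ⟨_, _, h₂⟩ := h₂
  obtain ⟨h, h', h₃⟩ := h₃
  obtain ⟨e₀, e₁, e₂, e₃⟩ := δ_chainFour (c := c) h h' h''
  refine ⟨h', h'', e₀ ▸ .fill _ _ fun j hj ↦ ?_⟩
  fin_cases j
  exacts [absurd rfl hj, e₁.symm ▸ h₁, e₂.symm ▸ h₂, e₃.symm ▸ h₃]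

lemma Fills.face_one (h₀ : c.Fills A q r s) (h₂ : c.Fills A p q s) (h₃ : c.Fills A p q r) :
    c.Fills A p r s := by
  obtain ⟨h', h'', h₀⟩ := h₀
  obtain ⟨_, _, h₂⟩ := h₂
  obtain ⟨h, _, h₃⟩ := h₃
  obtain ⟨e₀, e₁, e₂, e₃⟩ := δ_chainFour (c := c) h h' h''
  refine ⟨h.trans h', h'', e₁ ▸ .fill _ _ fun j hj ↦ ?_⟩
  fin_cases j
  exacts [e₀.symm ▸ h₀, absurd rfl hj, e₂.symm ▸ h₂, e₃.symm ▸ h₃]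

lemma Fills.face_two (h₀ : c.Fills A q r s) (h₁ : c.Fills A p r s) (h₃ : c.Fills A p q r) :
    c.Fills A p q s := by
  obtain ⟨h', h'', h₀⟩ := h₀
  obtain ⟨_, _, h₁⟩ := h₁
  obtain ⟨h, _, h₃⟩ := h₃
  obtain ⟨e₀, e₁, e₂, e₃⟩ := δ_chainFour (c := c) h h' h''
  refine ⟨h, h'.trans h'', e₂ ▸ .fill _ _ fun j hj ↦ ?_⟩
  fin_cases j
  exacts [e₀.symm ▸ h₀, e₁.symm ▸ h₁, absurd rfl hj, e₃.symm ▸ h₃]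

lemma Fills.face_three (h₀ : c.Fills A q r s) (h₁ : c.Fills A p r s) (h₂ : c.Fills A p q s) :
    c.Fills A p q r := by
  obtain ⟨h', h'', h₀⟩ := h₀
  obtain ⟨_, _, h₁⟩ := h₁
  obtain ⟨h, _, h₂⟩ := h₂
  obtain ⟨e₀, e₁, e₂, e₃⟩ := δ_chainFour (c := c) h h' h''
  refine ⟨h, h', e₃ ▸ .fill _ _ fun j hj ↦ ?_⟩
  fin_cases j
  exacts [e₀.symm ▸ h₀, e₁.symm ▸ h₁, e₂.symm ▸ h₂, absurd rfl hj]

lemma fill_of_fills (h : ∀ p q r : P, p ≤ q → q ≤ r → c.Fills A p q r) (x : B _⦋2⦌) :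
    Fill A x := by
  obtain ⟨g, rfl⟩ := c.surjective 2 x
  obtain ⟨_, _, h⟩ := h (g 0) (g 1) (g 2) (g.monotone (by decide)) (g.monotone (by decide))
  convert h
  ext i
  fin_cases i <;> rfl

end Chart

end SSet

/-! ### The loop and the prisms over it. -/

namespace EpsSSet

open Simplicial

lemma toRed_ofMarking_eq_iff {M : Type} {w : M → Δ[1] _⦋1⦌} {m : ℕ} (x y : Δ[1] _⦋m⦌) :
    (toRed (ofMarking Δ[1] M w)).app (op (.simplex (.mk m))) x =
      (toRed (ofMarking Δ[1] M w)).app (op (.simplex (.mk m))) y ↔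
    x = y ∨ (∀ i j, x i = x j) ∧ ∀ i j, y i = y j :=
  (toRed_app_eq_iff _ _ _).trans (or_congr Iff.rfl (and_congr
    (SSet.mem_skeleton_one_stdSimplex_iff x) (SSet.mem_skeleton_one_stdSimplex_iff y)))

lemma toRed_ofMarking_surjective (M : Type) (w : M → Δ[1] _⦋1⦌) (U : EpsCatᵒᵖ) :
    Function.Surjective ((toRed (ofMarking Δ[1] M w)).app U) :=
  toRed_surjective _ (SSet.stdSimplex.obj₀Equiv.symm 0) U

/-- The simplices of the loop `(Sim^1)_red`. -/
noncomputable def loop {m : ℕ} (x : Δ[1] _⦋m⦌) : (underlying (red (sim 1))) _⦋m⦌ :=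
  (toRed (sim 1)).app (op (.simplex (.mk m))) x

lemma loop_eq_iff {m : ℕ} (x y : Δ[1] _⦋m⦌) :
    loop x = loop y ↔ x = y ∨ (∀ i j, x i = x j) ∧ ∀ i j, y i = y j :=
  toRed_ofMarking_eq_iff x y

lemma loop_surjective (m : ℕ) : Function.Surjective (loop (m := m)) :=
  toRed_ofMarking_surjective _ _ _

lemma map_loop {m m' : ℕ} (f : SimplexCategory.mk m' ⟶ .mk m) (x : Δ[1] _⦋m⦌) :
    (underlying (red (sim 1))).map f.op (loop x) = loop (Δ[1].map f.op x) :=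
  (NatTrans.naturality_apply (toRed (sim 1)) (EpsCat.incl.map f).op x).symm

/-- The product of a simplex with the loop. -/
noncomputable abbrev prism (n : ℕ) : SSet.{0} := Δ[n] ⊗ underlying (red (sim 1))

/-- The simplices of the prism. -/
noncomputable def prismChart (n : ℕ) : SSet.Chart (Fin (n + 1) × Fin 2) (prism n) where
  simplex {m} g := ⟨SSet.stdSimplex.objMk (n := .mk n) (m := op (.mk m)) (OrderHom.fst.comp g),
    loop (SSet.stdSimplex.objMk (OrderHom.snd.comp g))⟩
  δ_simplex g j := Prod.ext rfl (map_loop _ _)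
  surjective m := by
    rintro ⟨x, y⟩
    obtain ⟨f, rfl⟩ := SSet.stdSimplex.objMk_bijective.2 x
    obtain ⟨y, rfl⟩ := loop_surjective m y
    obtain ⟨f', rfl⟩ := SSet.stdSimplex.objMk_bijective.2 y
    exact ⟨f.prod f', rfl⟩

end EpsSSet

namespace EpsSSet

open Simplicial SSet.Chart

lemma prismChart_simplex_const {n m : ℕ} (g g' : Fin (m + 1) →o Fin (n + 1) × Fin 2)
    (h : ∀ i, (g i).1 = (g' i).1) (h₁ : ∀ i j, (g i).2 = (g j).2)
    (h₂ : ∀ i j, (g' i).2 = (g' j).2) :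
    (prismChart n).simplex g = (prismChart n).simplex g' :=
  Prod.ext (SSet.stdSimplex.ext _ _ h) ((loop_eq_iff _ _).2 (Or.inr ⟨h₁, h₂⟩))

/-- The loop has a single vertex, so horizontal triangles at heights 0 and 1 are the same simplex.
-/
lemma fills_prism_const {n : ℕ} {A : (prism n).Subcomplex} {a b c : Fin (n + 1)} (i j : Fin 2)
    (h : (prismChart n).Fills A (a, i) (b, i) (c, i)) :
    (prismChart n).Fills A (a, j) (b, j) (c, j) := by
  obtain ⟨h, h', H⟩ := h
  refine ⟨⟨h.1, le_rfl⟩, ⟨h'.1, le_rfl⟩, ?_⟩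
  convert H using 1
  refine prismChart_simplex_const _ _ ?_ ?_ ?_
  · intro k; fin_cases k <;> rfl
  · intro k l; fin_cases k <;> fin_cases l <;> rfl
  · intro k l; fin_cases k <;> fin_cases l <;> rfl

/-- The triangles of the prism over `Δ^3` which lie over `∂₀Δ^3 ∪ ∂₂Δ^3`, or in one of the sections
of the projection to `Δ^3` given by the constant map and by `(0, 1, 1, 1)`. -/
abbrev PrismThreeBase (p q r : Fin 4 × Fin 2) : Prop :=
  (p.1 ≠ 0 ∧ q.1 ≠ 0 ∧ r.1 ≠ 0) ∨ (p.1 ≠ 2 ∧ q.1 ≠ 2 ∧ r.1 ≠ 2) ∨ (p.2 = q.2 ∧ q.2 = r.2) ∨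
    ((p.2 = 0 ↔ p.1 = 0) ∧ (q.2 = 0 ↔ q.1 = 0) ∧ (r.2 = 0 ↔ r.1 = 0))

-- The four exceptional triangles are the ones that `prism_three_mem` obtains by filling.
set_option synthInstance.maxHeartbeats 400000 in
set_option synthInstance.maxSize 4000 in
lemma prismThree_cases : ∀ p q r : Fin 4 × Fin 2, p ≤ q → q ≤ r → PrismThreeBase p q r ∨
    (p, q, r) = ((0, 0), (2, 0), (3, 1)) ∨ (p, q, r) = ((0, 0), (1, 0), (2, 1)) ∨
    (p, q, r) = ((0, 0), (2, 0), (2, 1)) ∨ (p, q, r) = ((0, 0), (0, 1), (2, 1)) := by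
  decide +kernel

/-- The triangles of the prism over `Δ^2` which lie over one of the two sides `∂ᵢΔ^2` and `∂ⱼΔ^2`,
or in one of the sections of the projection to `Δ^2` given by `(0, 0, 1)` and `(0, 1, 1)`. -/
abbrev PrismTwoBase (i j : Fin 3) (p q r : Fin 3 × Fin 2) : Prop :=
  (p.1 ≠ i ∧ q.1 ≠ i ∧ r.1 ≠ i) ∨ (p.1 ≠ j ∧ q.1 ≠ j ∧ r.1 ≠ j) ∨
    ((p.2 = 1 ↔ p.1 = 2) ∧ (q.2 = 1 ↔ q.1 = 2) ∧ (r.2 = 1 ↔ r.1 = 2)) ∨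
    ((p.2 = 0 ↔ p.1 = 0) ∧ (q.2 = 0 ↔ q.1 = 0) ∧ (r.2 = 0 ↔ r.1 = 0))

set_option synthInstance.maxHeartbeats 400000 in
set_option synthInstance.maxSize 4000 in
lemma prismTwoFirst_cases : ∀ p q r : Fin 3 × Fin 2, p ≤ q → q ≤ r → PrismTwoBase 1 2 p q r ∨
    (p.1 ≠ 0 ∧ q.1 ≠ 0 ∧ r.1 ≠ 0 ∧ p.2 = q.2 ∧ q.2 = r.2) ∨
    (p, q, r) = ((0, 0), (1, 0), (2, 0)) ∨ (p, q, r) = ((0, 1), (1, 1), (2, 1)) ∨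
    (p, q, r) = ((1, 0), (1, 1), (2, 1)) ∨ (p, q, r) = ((1, 0), (2, 0), (2, 1)) := by
  decide +kernel

set_option synthInstance.maxHeartbeats 400000 in
set_option synthInstance.maxSize 4000 in
lemma prismTwoLast_cases : ∀ p q r : Fin 3 × Fin 2, p ≤ q → q ≤ r → PrismTwoBase 0 1 p q r ∨
    (p.1 ≠ 2 ∧ q.1 ≠ 2 ∧ r.1 ≠ 2 ∧ p.2 = q.2 ∧ q.2 = r.2) ∨
    (p, q, r) = ((0, 0), (1, 0), (2, 0)) ∨ (p, q, r) = ((0, 1), (1, 1), (2, 1)) ∨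
    (p, q, r) = ((0, 0), (1, 0), (1, 1)) ∨ (p, q, r) = ((0, 0), (0, 1), (1, 1)) := by
  decide +kernel

variable {W : MorphismProperty SSet.{0}} (hW : IsWeaklySaturated W)
  (hcell : ∀ n ≥ 3, W (SSet.boundary n).ι)

include hW hcell

/-- For `n ≥ 3` the boundary contains all simplices of `Δ^n` of dimension at most 2, so only cells
of dimension at least 3 are missing. -/
lemma boundary_prism_mem (n : ℕ) (hn : 3 ≤ n) :
    W (Subfunctor.preimage (SSet.boundary n)
      (CartesianMonoidalCategory.fst Δ[n] (underlying (red (sim 1))))).ι := by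
  have (m : ℕ) : Finite (prism n _⦋m⦌) := (prismChart n).finite m
  refine SSet.ι_mem_of_dim_le_two hW hcell _ fun m hm x ↦ ?_
  change x.1 ∈ (SSet.boundary n).obj _
  rw [SSet.boundary_obj_eq_univ m n (by lia)]
  trivial

variable (hhorn : ∀ n ≥ 3, ∀ i, W (SSet.horn n i).ι)

include hhorn

/-- For `n ≥ 4` the horn contains the 2-skeleton of `Δ^n`. For `n = 3` the missing triangles lie
over the missing face, and each is the last face of a tetrahedron lying over the identity of `Δ^3`.
-/
lemma horn_prism_mem (n : ℕ) (hn : 3 ≤ n) (i : Fin (n + 1)) :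
    W (Subfunctor.preimage (SSet.horn n i)
      (CartesianMonoidalCategory.fst Δ[n] (underlying (red (sim 1))))).ι := by
  have (n m : ℕ) : Finite (prism n _⦋m⦌) := (prismChart n).finite m
  obtain hn | rfl := Nat.lt_or_eq_of_le hn
  · refine SSet.ι_mem_of_dim_le_two hW hcell _ fun m hm x ↦ ?_
    change x.1 ∈ (SSet.horn n i).obj _
    rw [SSet.horn_obj_eq_univ i m (by lia)]
    trivial
  · refine SSet.ι_mem_of_fill hW hcell (hhorn 3 le_rfl) _ ?_
    rintro ⟨x, y⟩
    by_cases hx : x ∈ (SSet.horn 3 i).obj _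
    · exact .base _ hx
    · obtain ⟨f, rfl⟩ := SSet.stdSimplex.objEquiv.symm.surjective x
      obtain rfl : f = SimplexCategory.δ i := by
        obtain hf | ⟨g, hg, rfl⟩ := SSet.epi_or_of_notMem_horn f i hx
        · exact absurd (SimplexCategory.len_le_of_epi f) (by decide)
        · rw [SimplexCategory.eq_id_of_epi g, Category.id_comp]
      -- A retraction `s` of the `i`-th coface extends the loop coordinate `y` from the missing face
      -- to the whole tetrahedron.
      obtain ⟨s, hs⟩ : ∃ s : ⦋3⦌ ⟶ ⦋2⦌,
          SimplexCategory.δ i ≫ s = 𝟙 _ := by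
        obtain rfl | ⟨j, rfl⟩ := i.eq_zero_or_eq_succ
        · exact ⟨_, SimplexCategory.δ_comp_σ_self (i := 0)⟩
        · exact ⟨_, SimplexCategory.δ_comp_σ_succ (i := j)⟩
      let σ : prism 3 _⦋3⦌ :=
        ⟨SSet.stdSimplex.objEquiv.symm (𝟙 _), (underlying (red (sim 1))).map s.op y⟩
      have hσ : (prism 3).δ i σ = ⟨SSet.stdSimplex.objEquiv.symm (SimplexCategory.δ i), y⟩ := by
        refine Prod.ext rfl ?_
        change (underlying (red (sim 1))).map _ ((underlying (red (sim 1))).map s.op y) = y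
        rw [← comp_apply, ← Functor.map_comp, ← op_comp, hs, op_id,
          CategoryTheory.Functor.map_id, id_apply]
      rw [← hσ]
      refine .fill σ i fun j hj ↦ .base _ ?_
      have : SSet.stdSimplex.face {j}ᶜ ≤ SSet.horn.{0} 3 i := SSet.face_le_horn j i hj
      rw [SSet.stdSimplex.face_singleton_compl, SSet.Subcomplex.ofSimplex_le_iff] at this
      exact this

lemma prism_three_mem (A : (prism 3).Subcomplex)
    (hA : ∀ p q r h h', PrismThreeBase p q r →
      (prismChart 3).simplex (chainThree p q r h h') ∈ A.obj _) : W A.ι := by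
  have (m : ℕ) : Finite (prism 3 _⦋m⦌) := (prismChart 3).finite m
  have base {p q r : Fin 4 × Fin 2} (H : p ≤ q ∧ q ≤ r ∧ PrismThreeBase p q r) :
      (prismChart 3).Fills A p q r := ⟨H.1, H.2.1, .base _ (hA p q r _ _ H.2.2)⟩
  -- In each tetrahedron the three given faces lie over the two sides of `Δ^3` or in one of the
  -- sections; only `h₃` uses an earlier filling, namely `h₂`.
  have h₁ : (prismChart 3).Fills A (0, 0) (2, 0) (3, 1) :=
    .face_one (q := (1, 0)) (base (by decide)) (base (by decide)) (base (by decide))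
  have h₂ : (prismChart 3).Fills A (0, 0) (1, 0) (2, 1) :=
    .face_two (r := (1, 1)) (base (by decide)) (base (by decide)) (base (by decide))
  have h₃ : (prismChart 3).Fills A (0, 0) (2, 0) (2, 1) :=
    .face_one (q := (1, 0)) (base (by decide)) h₂ (base (by decide))
  have h₄ : (prismChart 3).Fills A (0, 0) (0, 1) (2, 1) :=
    .face_two (r := (1, 1)) (base (by decide)) (base (by decide)) (base (by decide))
  refine SSet.ι_mem_of_fill hW hcell (hhorn 3 le_rfl) A
    ((prismChart 3).fill_of_fills fun p q r h h' ↦ ?_)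
  obtain H | H | H | H | H := prismThree_cases p q r h h'
  · exact base ⟨h, h', H⟩
  all_goals
    simp only [Prod.mk.injEq] at H
    obtain ⟨rfl, rfl, rfl⟩ := H
    assumption

lemma prism_two_first_mem (A : (prism 2).Subcomplex)
    (hA : ∀ p q r h h', PrismTwoBase 1 2 p q r →
      (prismChart 2).simplex (chainThree p q r h h') ∈ A.obj _) : W A.ι := by
  have (m : ℕ) : Finite (prism 2 _⦋m⦌) := (prismChart 2).finite m
  have base {p q r : Fin 3 × Fin 2} (H : p ≤ q ∧ q ≤ r ∧ PrismTwoBase 1 2 p q r) :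
      (prismChart 2).Fills A p q r := ⟨H.1, H.2.1, .base _ (hA p q r _ _ H.2.2)⟩
  -- Every tetrahedron here starts at `(0, 0)` and gains its face opposite to that vertex, as the
  -- first `ε`-horn suggests. The horizontal triangle is first obtained at height 1 and then moved
  -- to height 0, where `h₃` needs it.
  have h₁ : (prismChart 2).Fills A (0, 1) (1, 1) (2, 1) :=
    .face_zero (p := (0, 0)) (base (by decide)) (base (by decide)) (base (by decide))
  have h₁' : (prismChart 2).Fills A (0, 0) (1, 0) (2, 0) := fills_prism_const 1 0 h₁
  have h₂ : (prismChart 2).Fills A (1, 0) (1, 1) (2, 1) :=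
    .face_zero (p := (0, 0)) (base (by decide)) (base (by decide)) (base (by decide))
  have h₃ : (prismChart 2).Fills A (1, 0) (2, 0) (2, 1) :=
    .face_zero (p := (0, 0)) (base (by decide)) (base (by decide)) h₁'
  refine SSet.ι_mem_of_fill hW hcell (hhorn 3 le_rfl) A
    ((prismChart 2).fill_of_fills fun p q r h h' ↦ ?_)
  obtain H | ⟨hp, hq, hr, e₁, e₂⟩ | H | H | H | H := prismTwoFirst_cases p q r h h'
  · exact base ⟨h, h', H⟩
  · obtain ⟨p, i⟩ := p
    obtain ⟨q, j⟩ := q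
    obtain ⟨r, k⟩ := r
    obtain rfl : i = j := e₁
    obtain rfl : i = k := e₂
    -- At height 1 a triangle avoiding the vertex 0 lies in the section `(0, 1, 1)`.
    exact fills_prism_const 1 i (base ⟨⟨h.1, le_rfl⟩, ⟨h'.1, le_rfl⟩,
      Or.inr (Or.inr (Or.inr ⟨iff_of_false one_ne_zero hp,
        iff_of_false one_ne_zero hq, iff_of_false one_ne_zero hr⟩))⟩)
  all_goals
    simp only [Prod.mk.injEq] at H
    obtain ⟨rfl, rfl, rfl⟩ := H
    assumption

lemma prism_two_last_mem (A : (prism 2).Subcomplex)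
    (hA : ∀ p q r h h', PrismTwoBase 0 1 p q r →
      (prismChart 2).simplex (chainThree p q r h h') ∈ A.obj _) : W A.ι := by
  have (m : ℕ) : Finite (prism 2 _⦋m⦌) := (prismChart 2).finite m
  have base {p q r : Fin 3 × Fin 2} (H : p ≤ q ∧ q ≤ r ∧ PrismTwoBase 0 1 p q r) :
      (prismChart 2).Fills A p q r := ⟨H.1, H.2.1, .base _ (hA p q r _ _ H.2.2)⟩
  -- The mirror image of the first case: all tetrahedra end at `(2, 1)` and gain the face opposite
  -- to it.
  have h₁ : (prismChart 2).Fills A (0, 0) (1, 0) (2, 0) :=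
    .face_three (s := (2, 1)) (base (by decide)) (base (by decide)) (base (by decide))
  have h₁' : (prismChart 2).Fills A (0, 1) (1, 1) (2, 1) := fills_prism_const 0 1 h₁
  have h₂ : (prismChart 2).Fills A (0, 0) (1, 0) (1, 1) :=
    .face_three (s := (2, 1)) (base (by decide)) (base (by decide)) (base (by decide))
  have h₃ : (prismChart 2).Fills A (0, 0) (0, 1) (1, 1) :=
    .face_three (s := (2, 1)) h₁' (base (by decide)) (base (by decide))
  refine SSet.ι_mem_of_fill hW hcell (hhorn 3 le_rfl) A
    ((prismChart 2).fill_of_fills fun p q r h h' ↦ ?_)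
  obtain H | ⟨hp, hq, hr, e₁, e₂⟩ | H | H | H | H := prismTwoLast_cases p q r h h'
  · exact base ⟨h, h', H⟩
  · obtain ⟨p, i⟩ := p
    obtain ⟨q, j⟩ := q
    obtain ⟨r, k⟩ := r
    obtain rfl : i = j := e₁
    obtain rfl : i = k := e₂
    exact fills_prism_const 0 i (base ⟨⟨h.1, le_rfl⟩, ⟨h'.1, le_rfl⟩,
      Or.inr (Or.inr (Or.inl ⟨iff_of_false zero_ne_one hp,
        iff_of_false zero_ne_one hq, iff_of_false zero_ne_one hr⟩))⟩)
  all_goals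
    simp only [Prod.mk.injEq] at H
    obtain ⟨rfl, rfl, rfl⟩ := H
    assumption

end EpsSSet

/-! ### Maps between the `Sim^n` and the contents of the `ε`-horns. -/

namespace EpsSSet

open Simplicial

section Maps

/-- The map `Δ^n ⟶ Δ^k` given by a monotone map on the vertices. -/
def simplexMap {n k : ℕ} (τ : Fin (n + 1) →o Fin (k + 1)) : Δ[n] ⟶ (Δ[k] : SSet.{0}) :=
  SSet.stdSimplex.map (SimplexCategory.mkHom τ)

lemma simplexMap_apply {n k m : ℕ} (τ : Fin (n + 1) →o Fin (k + 1)) (x : Δ[n] _⦋m⦌)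
    (i : Fin (m + 1)) : (simplexMap τ).app (op (.mk m)) x i = τ (x i) := rfl

/-- The map `Sim^n ⟶ Sim^k` given by a monotone map preserving the first and last vertex. -/
def simMap {n k : ℕ} (τ : Fin (n + 1) →o Fin (k + 1)) (h₀ : τ 0 = 0)
    (h₁ : τ (Fin.last n) = Fin.last k) : sim n ⟶ sim k where
  app U := match U with
    | ⟨.simplex m⟩ => (simplexMap τ).app (op m)
    | ⟨.eps⟩ => 𝟙 Unit
  naturality {U V} g := by
    have hw : (simplexMap τ).app (op (.mk 1))
        (SSet.stdSimplex.edge n 0 (Fin.last n) (Fin.zero_le _)) =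
        SSet.stdSimplex.edge k 0 (Fin.last k) (Fin.zero_le _) :=
      SSet.stdSimplex.ext _ _ fun i ↦ by
        fin_cases i
        exacts [h₀, h₁]
    obtain ⟨u | _⟩ := U
    · obtain ⟨v | _⟩ := V
      · exact (simplexMap τ).naturality (Quiver.Hom.op (V := SimplexCategory) g.unop)
      · exact Empty.elim g.unop
    · obtain ⟨v | _⟩ := V
      · refine ConcreteCategory.hom_ext _ _ fun s ↦ ?_
        refine (NatTrans.naturality_apply (simplexMap τ)
          (Quiver.Hom.op (V := SimplexCategory) g.unop) _).trans ?_
        exact congrArg _ hw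
      · rfl

end Maps

section Horns

variable {n m : ℕ}

lemma mem_epsHorn_obj_iff (i : Fin (n + 1)) {U : EpsCatᵒᵖ} (x : (sim n).obj U) :
    x ∈ (epsHorn n i).obj U ↔ ∃ j ≠ i, x ∈ (simFace n j).obj U := by
  simp only [epsHorn, Subfunctor.iSup_obj, Set.mem_iUnion, exists_prop]

lemma mem_epsHorn_iff (i : Fin (n + 1)) (x : Δ[n] _⦋m⦌) :
    x ∈ (epsHorn n i).obj (op (.simplex (.mk m))) ↔ ∃ j ≠ i, ∀ k, x k ≠ j := by
  refine (mem_epsHorn_obj_iff i (U := op (.simplex (.mk m))) x).trans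
    (exists_congr fun j ↦ and_congr_right fun _ ↦ (SSet.stdSimplex.mem_face_iff _ x).trans ?_)
  simp only [Finset.mem_compl, Finset.mem_singleton, ne_eq]

lemma under_epsHorn (i : Fin (n + 1)) : under (epsHorn n i) = SSet.horn n i := by
  ext ⟨⟨m⟩⟩ x
  refine (mem_epsHorn_iff i x).trans (Iff.trans ?_ (SSet.mem_horn_iff_notMem_range x i).symm)
  simp

/-- For `n ≥ 2` the vertex 1 can be chosen different from the omitted index, and the face opposite
to it contains the edge from 0 to `n` unless 1 is an endpoint. This needs `1 ≠ n`, which is why the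
1-dimensional `ε`-horns need a separate argument. -/
lemma witness_mem_epsHorn (hn : 2 ≤ n) (i : Fin (n + 1)) (hi : i = 0 ∨ i = Fin.last n)
    (w : (sim n).obj (op .eps)) : w ∈ (epsHorn n i).obj (op .eps) := by
  have h₀ : (⟨1, by lia⟩ : Fin (n + 1)) ≠ 0 := by simp [Fin.ext_iff]
  have h₁ : (⟨1, by lia⟩ : Fin (n + 1)) ≠ Fin.last n := by simp [Fin.ext_iff]; lia
  rw [mem_epsHorn_obj_iff]
  refine ⟨⟨1, by lia⟩, by rintro rfl; simp_all, ?_⟩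
  change SSet.stdSimplex.edge n 0 (Fin.last n) _ ∈ (SSet.stdSimplex.face _).obj (op (.mk 1))
  rw [SSet.stdSimplex.mem_face_iff]
  intro k
  rw [Finset.mem_compl, Finset.mem_singleton]
  fin_cases k
  exacts [h₀.symm, h₁.symm]

end Horns

variable {W : MorphismProperty EpsSSet} (hW : IsWeaklySaturated W)

include hW

lemma unmarked_whiskerRight_mem {T : SSet.{0}} (A : T.Subcomplex) (Y : EpsSSet)
    (h : W (unmarked.map (Subfunctor.preimage A
      (CartesianMonoidalCategory.fst T (underlying Y))).ι)) : W (unmarked.map A.ι ▷ Y) := by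
  refine whiskerRight_mem hW _ _ (ι_mem_of_under hW _ (fun w ↦ Empty.elim w.1) ?_)
  have : under (Subfunctor.preimage (Subfunctor.range (unmarked.map A.ι))
      (CartesianMonoidalCategory.fst (unmarked.obj T) Y)) =
      Subfunctor.preimage A (CartesianMonoidalCategory.fst T (underlying Y)) := by
    ext U ⟨x, y⟩
    exact ⟨fun ⟨z, hz⟩ ↦ (show z.1 = x from hz) ▸ z.2, fun h ↦ ⟨⟨x, h⟩, rfl⟩⟩
  exact this ▸ h

lemma ι_whiskerRight_mem {B : EpsSSet} (A : Subfunctor B)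
    (hA : ∀ w : B.obj (op .eps), w ∈ A.obj _) (Y : EpsSSet)
    (h : W (unmarked.map (Subfunctor.preimage (under A)
      (CartesianMonoidalCategory.fst (underlying B) (underlying Y))).ι)) : W (A.ι ▷ Y) := by
  refine whiskerRight_mem hW _ _ ?_
  rw [Subfunctor.range_ι]
  exact ι_mem_of_under hW _ (fun w ↦ hA w.1) h

end EpsSSet

/-! ### The generators other than the 1-dimensional `ε`-horns. -/

namespace EpsSSet

open Simplicial

/-- The morphism from `Δ^n` to the loop given by a monotone map on the vertices. -/
noncomputable def simplexLoop {n : ℕ} (τ : Fin (n + 1) →o Fin 2) :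
    unmarked.obj Δ[n] ⟶ red (sim 1) :=
  fromUnmarked (X := sim 1) (simplexMap τ) ≫ toRed (sim 1)

/-- The morphism from `Sim^n` to the loop given by a monotone map on the vertices. -/
noncomputable def simLoop {n : ℕ} (τ : Fin (n + 1) →o Fin 2) (h₀ : τ 0 = 0)
    (h₁ : τ (Fin.last n) = 1) : sim n ⟶ red (sim 1) :=
  simMap τ h₀ h₁ ≫ toRed (sim 1)

lemma loop_simplexMap_eq_iff {n m : ℕ} (τ τ' : Fin (n + 1) →o Fin 2) (x y : Δ[n] _⦋m⦌) :
    loop ((simplexMap τ).app (op (.mk m)) x) = loop ((simplexMap τ').app (op (.mk m)) y) ↔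
      (∀ i, τ (x i) = τ' (y i)) ∨ (∀ i j, τ (x i) = τ (x j)) ∧ ∀ i j, τ' (y i) = τ' (y j) := by
  rw [loop_eq_iff]
  refine or_congr ⟨fun h i ↦ ?_, fun h ↦ SSet.stdSimplex.ext _ _ h⟩ Iff.rfl
  rw [← simplexMap_apply, h, simplexMap_apply]

variable {W : MorphismProperty EpsSSet} (hW : IsWeaklySaturated W) (hgen : basicGenerators ≤ W)

include hgen

lemma cell_mem (n : ℕ) (hn : n ≥ 3) : W.inverseImage unmarked (SSet.boundary n).ι :=
  hgen _ (.cell n hn)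

lemma horn_mem (n : ℕ) (hn : n ≥ 3) (i : Fin (n + 1)) :
    W.inverseImage unmarked (SSet.horn n i).ι :=
  hgen _ (.horn n hn i)

include hW

lemma cell_whiskerRight_mem (n : ℕ) (hn : 3 ≤ n) :
    W (unmarked.map (SSet.boundary n).ι ▷ red (sim 1)) :=
  unmarked_whiskerRight_mem hW _ _
    (boundary_prism_mem (hW.inverseImage unmarked) (cell_mem hgen) n hn)

lemma horn_whiskerRight_mem (n : ℕ) (hn : 3 ≤ n) (i : Fin (n + 1)) :
    W (unmarked.map (SSet.horn n i).ι ▷ red (sim 1)) :=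
  unmarked_whiskerRight_mem hW _ _
    (horn_prism_mem (hW.inverseImage unmarked) (cell_mem hgen) (horn_mem hgen) n hn i)

lemma epsHorn_whiskerRight_mem (n : ℕ) (hn : 3 ≤ n) (i : Fin (n + 1))
    (hi : i = 0 ∨ i = Fin.last n) : W ((epsHorn n i).ι ▷ red (sim 1)) := by
  refine ι_whiskerRight_mem hW _ (witness_mem_epsHorn (by lia) i hi) _ ?_
  rw [under_epsHorn]
  exact horn_prism_mem (hW.inverseImage unmarked) (cell_mem hgen) (horn_mem hgen) n hn i

/-- The sections given by the constant 0 and by `(0, 1, 1, 1)` are attached first. They agree in the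
loop only on simplices that avoid 0, or that are constant at 0 and so avoid 2; these lie in the
given two faces. Horn filling does the rest. -/
lemma assoc_whiskerRight_mem :
    W (unmarked.map (SSet.stdSimplex.face {0}ᶜ ⊔ SSet.stdSimplex.face {2}ᶜ :
      (SSet.stdSimplex.obj (SimplexCategory.mk 3)).Subcomplex).ι ▷ red (sim 1)) := by
  refine whiskerRight_mem hW _ _ ?_
  set A : (SSet.stdSimplex.obj (SimplexCategory.mk 3)).Subcomplex :=
    SSet.stdSimplex.face {0}ᶜ ⊔ SSet.stdSimplex.face {2}ᶜ with hA
  have mem (m : ℕ) (x : Δ[3] _⦋m⦌) (h : (∀ i, x i ≠ 0) ∨ ∀ i, x i ≠ 2) : x ∈ A.obj _ := by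
    obtain h | h := h
    · exact Or.inl ((SSet.stdSimplex.mem_face_iff _ x).2 (by simpa using h))
    · exact Or.inr ((SSet.stdSimplex.mem_face_iff _ x).2 (by simpa using h))
  let τ : Fin 4 →o Fin 2 := ⟨![0, 1, 1, 1], by decide⟩
  have hA' : W (Subfunctor.range (unmarked.map A.ι)).ι :=
    (Subfunctor.range_ι_mem_iff hW _).2 (hgen _ .assoc)
  obtain ⟨hle, h⟩ := extends_graph_graph hW hA' (simplexLoop (OrderHom.const _ 0)) (simplexLoop τ)
    (by
      rintro ⟨⟨⟨m⟩⟩ | _⟩ x hx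
      · change (Δ[3] _⦋m⦌ : Type) at x
        refine ⟨⟨x, mem m x ?_⟩, rfl⟩
        have hx := (loop_simplexMap_eq_iff _ _ x x).1 hx
        have key : ∀ a : Fin 4, 0 = τ a → a ≠ 2 := by decide
        have key' : ∀ a b : Fin 4, τ a = τ b → a = 0 → b = 0 := by decide
        obtain hx | ⟨-, hx⟩ := hx
        · exact Or.inr fun i ↦ key _ (hx i)
        · by_cases h : ∃ i, x i = 0
          · obtain ⟨i, hi⟩ := h
            refine Or.inr fun j ↦ ?_
            rw [key' _ _ (hx i j) hi]
            decide
          · exact Or.inl (not_exists.1 h)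
      · exact Empty.elim x)
  refine Subfunctor.Extends.ι_mem hW ⟨hle, h⟩ (ι_mem_of_under hW _ (fun w ↦ Empty.elim w.1) ?_)
  refine prism_three_mem (hW.inverseImage unmarked) (cell_mem hgen) (horn_mem hgen) _ ?_
  intro p q r h h' H
  obtain H | H | H | H := H
  · refine Or.inl (Or.inl ⟨⟨SSet.stdSimplex.objMk _, mem 2 _ (Or.inl ?_)⟩, rfl⟩)
    intro i
    fin_cases i
    exacts [H.1, H.2.1, H.2.2]
  · refine Or.inl (Or.inl ⟨⟨SSet.stdSimplex.objMk _, mem 2 _ (Or.inr ?_)⟩, rfl⟩)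
    intro i
    fin_cases i
    exacts [H.1, H.2.1, H.2.2]
  -- The graph of the constant 0 also contains the triangles at constant height 1, since the two are
  -- identified in the loop.
  · refine Or.inl (Or.inr ⟨SSet.stdSimplex.objMk _, Prod.ext rfl
      ((loop_eq_iff _ _).2 (Or.inr ⟨fun _ _ ↦ rfl, ?_⟩))⟩)
    intro i j
    fin_cases i <;> fin_cases j
    exacts [rfl, H.1, H.1.trans H.2, H.1.symm, rfl, H.2, (H.1.trans H.2).symm, H.2.symm, rfl]
  · have key : ∀ p : Fin 4 × Fin 2, (p.2 = 0 ↔ p.1 = 0) → τ p.1 = p.2 := by decide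
    refine Or.inr ⟨SSet.stdSimplex.objMk _, Prod.ext rfl
      ((loop_eq_iff _ _).2 (Or.inl (SSet.stdSimplex.ext _ _ ?_)))⟩
    intro i
    fin_cases i
    exacts [key p H.1, key q H.2.1, key r H.2.2]

/-- The projection `0 ↦ 0, 1 ↦ i, 2 ↦ 1` from three to two elements. -/
abbrev proj (i : Fin 2) : Fin 3 →o Fin 2 := ⟨![0, i, 1], by revert i; decide⟩

/-- The sections must come from maps preserving the ends 0 and 2 so that they respect the witness;
`proj 0` and `proj 1` are the two possibilities. They differ at the vertex 1, so they agree only on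
the face opposite to 1 and on constant simplices. -/
lemma epsHorn_two_whiskerRight_mem (i : Fin 3) (hi : i = 0 ∨ i = Fin.last 2) :
    W ((epsHorn 2 i).ι ▷ red (sim 1)) := by
  refine whiskerRight_mem hW _ _ ?_
  rw [Subfunctor.range_ι]
  have mem (m : ℕ) (x : Δ[2] _⦋m⦌) (j : Fin 3) (hj : j ≠ i) (h : ∀ k, x k ≠ j) :
      x ∈ (epsHorn 2 i).obj (op (.simplex (.mk m))) := (mem_epsHorn_iff i x).2 ⟨j, hj, h⟩
  have hA : W (epsHorn 2 i).ι := by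
    obtain rfl | rfl := hi
    · exact hgen _ (.epsHornFirst 2 (by decide))
    · exact hgen _ (.epsHornLast 2 (by decide))
  have hwit := witness_mem_epsHorn le_rfl i hi
  have hi₁ : 1 ≠ i := by obtain rfl | rfl := hi <;> decide
  obtain ⟨hle, h⟩ := extends_graph_graph hW hA (simLoop (proj 0) rfl rfl)
    (simLoop (proj 1) rfl rfl) (by
      rintro ⟨⟨⟨m⟩⟩ | _⟩ x hx
      · change (Δ[2] _⦋m⦌ : Type) at x
        have hx := (loop_simplexMap_eq_iff _ _ x x).1 hx
        have key : ∀ a : Fin 3, proj 0 a = proj 1 a → a ≠ 1 := by decide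
        have key' : ∀ a b : Fin 3, proj 0 a = proj 0 b → proj 1 a = proj 1 b → a = b := by decide
        obtain hx | ⟨hx, hx'⟩ := hx
        · exact mem m x 1 hi₁ fun i ↦ key _ (hx i)
        -- Both projections being constant makes `x` constant at one vertex, so it avoids some `j`
        -- other than `i`.
        · have key'' : ∀ i a : Fin 3, ∃ j, j ≠ i ∧ j ≠ a := by decide
          obtain ⟨j, hj, hj'⟩ := key'' i (x 0)
          exact mem m x j hj fun k ↦ by rwa [key' _ _ (hx k 0) (hx' k 0), ne_comm]
      · exact hwit x)
  refine Subfunctor.Extends.ι_mem hW ⟨hle, h⟩ (ι_mem_of_under hW _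
    (fun w ↦ Or.inl (Or.inl (hwit w.1))) ?_)
  have base (j k : Fin 3) (hj : j ≠ i) (hk : k ≠ i) (p q r : Fin 3 × Fin 2) (h : p ≤ q)
      (h' : q ≤ r) (H : PrismTwoBase j k p q r) :
      (prismChart 2).simplex (chainThree p q r h h') ∈ (under (Subfunctor.preimage (epsHorn 2 i)
          (CartesianMonoidalCategory.fst (sim 2) (red (sim 1))) ⊔
        Subfunctor.range (graph (simLoop (proj 0) rfl rfl)) ⊔
        Subfunctor.range (graph (simLoop (proj 1) rfl rfl)))).obj _ := by
    obtain H | H | H | H := H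
    · refine Or.inl (Or.inl (mem 2 (SSet.stdSimplex.objMk _) j hj ?_))
      intro i
      fin_cases i
      exacts [H.1, H.2.1, H.2.2]
    · refine Or.inl (Or.inl (mem 2 (SSet.stdSimplex.objMk _) k hk ?_))
      intro i
      fin_cases i
      exacts [H.1, H.2.1, H.2.2]
    · have key : ∀ p : Fin 3 × Fin 2, (p.2 = 1 ↔ p.1 = 2) → proj 0 p.1 = p.2 := by decide
      refine Or.inl (Or.inr ⟨SSet.stdSimplex.objMk _, Prod.ext rfl
        ((loop_eq_iff _ _).2 (Or.inl (SSet.stdSimplex.ext _ _ ?_)))⟩)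
      intro i
      fin_cases i
      exacts [key p H.1, key q H.2.1, key r H.2.2]
    · have key : ∀ p : Fin 3 × Fin 2, (p.2 = 0 ↔ p.1 = 0) → proj 1 p.1 = p.2 := by decide
      refine Or.inr ⟨SSet.stdSimplex.objMk _, Prod.ext rfl
        ((loop_eq_iff _ _).2 (Or.inl (SSet.stdSimplex.ext _ _ ?_)))⟩
      intro i
      fin_cases i
      exacts [key p H.1, key q H.2.1, key r H.2.2]
  obtain rfl | rfl := hi
  · exact prism_two_first_mem (hW.inverseImage unmarked) (cell_mem hgen) (horn_mem hgen) _
      (base 1 2 (by decide) (by decide))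
  · exact prism_two_last_mem (hW.inverseImage unmarked) (cell_mem hgen) (horn_mem hgen) _
      (base 0 1 (by decide) (by decide))

end EpsSSet

/-! ### The 1-dimensional `ε`-horns. -/

namespace EpsSSet

open Simplicial

section

variable {m : ℕ}

lemma mem_epsHorn_one_iff (e : Fin 2) (x : Δ[1] _⦋m⦌) :
    x ∈ (epsHorn 1 e).obj (op (.simplex (.mk m))) ↔ ∀ k, x k = e := by
  rw [mem_epsHorn_iff]
  have key : ∀ e j a : Fin 2, j ≠ e → a ≠ j → a = e := by decide
  have key' : ∀ e : Fin 2, ∃ j, j ≠ e := by decide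
  constructor
  · rintro ⟨j, hj, h⟩ k
    exact key _ _ _ hj (h k)
  · intro h
    obtain ⟨j, hj⟩ := key' e
    exact ⟨j, hj, fun k ↦ (h k).trans_ne hj.symm⟩

/-- The index `![0, 2] e` treats both ends at once: the horn has the two faces opposite to 1 and to
the other end `![2, 0] e`. -/
lemma mem_epsHorn_two_iff (e : Fin 2) (x : Δ[2] _⦋m⦌) :
    x ∈ (epsHorn 2 (![0, 2] e)).obj (op (.simplex (.mk m))) ↔
      (∀ k, x k ≠ 1) ∨ ∀ k, x k ≠ ![2, 0] e := by
  rw [mem_epsHorn_iff]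
  have key : ∀ (e : Fin 2) (j : Fin 3), j ≠ ![0, 2] e → j = 1 ∨ j = ![2, 0] e := by decide
  have key' : ∀ e : Fin 2, (1 : Fin 3) ≠ ![0, 2] e ∧ (![2, 0] e : Fin 3) ≠ ![0, 2] e := by decide
  constructor
  · rintro ⟨j, hj, h⟩
    obtain rfl | rfl := key _ _ hj
    exacts [Or.inl h, Or.inr h]
  · rintro (h | h)
    exacts [⟨_, (key' e).1, h⟩, ⟨_, (key' e).2, h⟩]

/-- The morphism from `Sim^2` to the product of `Sim^1` and the loop, with components given by two
projections. -/
noncomputable def simTriangle (a b : Fin 2) : sim 2 ⟶ sim 1 ⊗ red (sim 1) :=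
  CartesianMonoidalCategory.lift (simMap (proj a) rfl rfl) (simLoop (proj b) rfl rfl)

lemma simTriangle_app_eq_iff (a b a' b' : Fin 2) (x y : Δ[2] _⦋m⦌) :
    (simTriangle a b).app (op (.simplex (.mk m))) x =
      (simTriangle a' b').app (op (.simplex (.mk m))) y ↔
    (∀ k, proj a (x k) = proj a' (y k)) ∧ ((∀ k, proj b (x k) = proj b' (y k)) ∨
      (∀ k l, proj b (x k) = proj b (x l)) ∧ ∀ k l, proj b' (y k) = proj b' (y l)) := by
  rw [← loop_simplexMap_eq_iff]
  constructor
  · intro h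
    have h₁ : (simplexMap (proj a)).app (op (.mk m)) x =
      (simplexMap (proj a')).app (op (.mk m)) y := congrArg Prod.fst h
    refine ⟨fun k ↦ ?_, congrArg Prod.snd h⟩
    rw [← simplexMap_apply, h₁, simplexMap_apply]
  · rintro ⟨h₁, h₂⟩
    exact Prod.ext (SSet.stdSimplex.ext _ _ h₁) h₂

/-- The part of the product of `Sim^1` and the loop generated by the fibre over the vertex `e` and
by the diagonal. -/
noncomputable abbrev fibreDiagonal (e : Fin 2) : Subfunctor (sim 1 ⊗ red (sim 1)) :=
  Subfunctor.preimage (epsHorn 1 e) (CartesianMonoidalCategory.fst (sim 1) (red (sim 1))) ⊔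
    Subfunctor.range (graph (toRed (sim 1)))

lemma mem_fibreDiagonal_iff (e a b : Fin 2) (x : Δ[2] _⦋m⦌) :
    (simTriangle a b).app (op (.simplex (.mk m))) x ∈ (fibreDiagonal e).obj _ ↔
      (∀ k, proj a (x k) = e) ∨ (∀ k, proj a (x k) = proj b (x k)) ∨
        (∀ k l, proj a (x k) = proj a (x l)) ∧ ∀ k l, proj b (x k) = proj b (x l) := by
  rw [← loop_simplexMap_eq_iff]
  refine or_congr (mem_epsHorn_one_iff e ((simplexMap (proj a)).app (op (.mk m)) x)) ⟨?_, ?_⟩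
  · rintro ⟨z, hz⟩
    obtain rfl : z = (simplexMap (proj a)).app (op (.mk m)) x := congrArg Prod.fst hz
    exact congrArg Prod.snd hz
  · exact fun h ↦ ⟨(simplexMap (proj a)).app (op (.mk m)) x, Prod.ext rfl h⟩

/-- Both factors have a single witness, so the product has only one, and it lies over the diagonal.
-/
lemma witness_mem_fibreDiagonal (e : Fin 2) (w : (sim 1 ⊗ red (sim 1)).obj (op .eps)) :
    w ∈ (fibreDiagonal e).obj (op .eps) := by
  obtain ⟨w, y⟩ := w
  obtain ⟨w', rfl⟩ := toRed_ofMarking_surjective _ _ _ y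
  exact Or.inr ⟨w, rfl⟩

lemma proj_injective {m : ℕ} (a b : Fin 2) (hab : a ≠ b) (x y : Δ[2] _⦋m⦌)
    (h : ∀ k, proj a (x k) = proj a (y k)) (h' : ∀ k, proj b (x k) = proj b (y k)) : x = y := by
  have key : ∀ a b : Fin 2, a ≠ b → ∀ v w : Fin 3, proj a v = proj a w →
    proj b v = proj b w → v = w := by decide
  exact SSet.stdSimplex.ext _ _ fun k ↦ key a b hab _ _ (h k) (h' k)

lemma mem_epsHorn_two_of_const (e a b : Fin 2) (hab : a ≠ b) (x : Δ[2] _⦋m⦌)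
    (h : ∀ k l, proj a (x k) = proj a (x l)) (h' : ∀ k l, proj b (x k) = proj b (x l)) :
    (∀ k, x k ≠ 1) ∨ ∀ k, x k ≠ ![2, 0] e := by
  have key : ∀ a b : Fin 2, a ≠ b → ∀ v w : Fin 3, proj a v = proj a w →
    proj b v = proj b w → v = w := by decide
  have key' : ∀ e : Fin 2, (1 : Fin 3) ≠ ![2, 0] e := by decide
  by_cases hx : x 0 = 1
  · exact Or.inr fun k ↦ by rw [key a b hab _ _ (h k 0) (h' k 0), hx]; exact key' e
  · exact Or.inl fun k ↦ by rwa [key a b hab _ _ (h k 0) (h' k 0)]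

/-- Of the three sides of this triangle, one is the diagonal, one lies in the fibre over `e`, and
the third is the vertical edge, which is new. -/
lemma preimage_simTriangle_first (e : Fin 2) :
    Subfunctor.preimage (fibreDiagonal e) (simTriangle e (1 - e)) = epsHorn 2 (![0, 2] e) := by
  ext ⟨⟨⟨m⟩⟩ | _⟩ x
  · change (Δ[2] _⦋m⦌ : Type) at x
    refine (mem_fibreDiagonal_iff e e (1 - e) x).trans (Iff.trans ?_ (mem_epsHorn_two_iff e x).symm)
    have key : ∀ (e : Fin 2) (v : Fin 3), proj e v = e ↔ v ≠ ![2, 0] e := by decide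
    have key' : ∀ (e : Fin 2) (v : Fin 3), proj e v = proj (1 - e) v ↔ v ≠ 1 := by decide
    have key'' : ∀ e : Fin 2, e ≠ 1 - e := by decide
    simp only [key, key']
    constructor
    · rintro (h | h | ⟨h, h'⟩)
      exacts [Or.inr h, Or.inl h, mem_epsHorn_two_of_const e e (1 - e) (key'' e) x h h']
    · rintro (h | h)
      exacts [Or.inr (Or.inl h), Or.inl h]
  · exact iff_of_true (witness_mem_fibreDiagonal e _)
      (witness_mem_epsHorn le_rfl _ (by revert e; decide) x)

/-- This triangle shares the diagonal and the vertical edge with what is already there. Its third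
side is the loop in the fibre over `1 - e`, which is new. -/
lemma preimage_simTriangle_second (e : Fin 2) :
    Subfunctor.preimage (fibreDiagonal e ⊔ Subfunctor.range (simTriangle e (1 - e)))
      (simTriangle (1 - e) e) = epsHorn 2 (![0, 2] e) := by
  ext ⟨⟨⟨m⟩⟩ | _⟩ x
  · change (Δ[2] _⦋m⦌ : Type) at x
    refine (or_congr (mem_fibreDiagonal_iff e (1 - e) e x) Iff.rfl).trans
      (Iff.trans ?_ (mem_epsHorn_two_iff e x).symm)
    have key : ∀ (e : Fin 2) (v : Fin 3), proj (1 - e) v = e → v ≠ 1 := by decide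
    have key₁ : ∀ (e : Fin 2) (v : Fin 3), proj (1 - e) v = proj e v ↔ v ≠ 1 := by decide
    have key₂ : ∀ e : Fin 2, 1 - e ≠ e := by decide
    have key₃ : ∀ (e : Fin 2) (v w : Fin 3), proj e v = proj (1 - e) w →
      proj (1 - e) v = proj e w → w ≠ 1 := by decide
    have key₄ : ∀ e : Fin 2, proj e 1 ≠ proj e (![2, 0] e) := by decide
    simp only [key₁]
    constructor
    · rintro ((h | h | ⟨h, h'⟩) | ⟨y, hy⟩)
      · exact Or.inl fun k ↦ key e _ (h k)
      · exact Or.inl h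
      · exact mem_epsHorn_two_of_const e (1 - e) e (key₂ e) x h h'
      · change (Δ[2] _⦋m⦌ : Type) at y
        obtain ⟨h, h' | ⟨-, h'⟩⟩ := (simTriangle_app_eq_iff _ _ _ _ y x).1 hy
        · exact Or.inl fun k ↦ key₃ e _ _ (h k) (h' k)
        · by_contra! H
          obtain ⟨⟨k, hk⟩, ⟨l, hl⟩⟩ := H
          have := h' k l
          rw [hk, hl] at this
          exact key₄ e this
    · rintro (h | h)
      · exact Or.inl (Or.inr (Or.inl h))
      -- `ρ e` carries the vertical side of the second triangle to that of the first. Their loop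
      -- coordinates are different constants, which agree after reduction.
      · let ρ : Fin 2 → (Fin 3 →o Fin 3) := ![⟨![1, 2, 2], by decide⟩, ⟨![0, 0, 1], by decide⟩]
        refine Or.inr ⟨(simplexMap (ρ e)).app (op (.mk m)) x, ?_⟩
        have h₀ : ∀ (e : Fin 2) (v : Fin 3), proj e (ρ e v) = proj (1 - e) v := by decide
        have h₁ : ∀ (e : Fin 2) (v w : Fin 3), proj (1 - e) (ρ e v) = proj (1 - e) (ρ e w) := by
          decide
        have h₂ : ∀ (e : Fin 2) (v w : Fin 3), v ≠ ![2, 0] e → w ≠ ![2, 0] e →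
          proj e v = proj e w := by decide
        exact (simTriangle_app_eq_iff _ _ _ _ ((simplexMap (ρ e)).app (op (.mk m)) x) x).2
          ⟨fun k ↦ h₀ e _, Or.inr ⟨fun k l ↦ h₁ e _ _, fun k l ↦ h₂ e _ _ (h k) (h l)⟩⟩
  · exact iff_of_true (Or.inl (witness_mem_fibreDiagonal e _))
      (witness_mem_epsHorn le_rfl _ (by revert e; decide) x)

/-- The vertices 0, 1, 2 of `Δ^2` correspond under `(proj 0, proj 1)` to the pairs `(0, 0)`, `(0,
1)`, `(1, 1)`. The value of `f` at `(1, 0)` is never used by `h₀` and `h₁`. -/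
lemma exists_proj_eq (x y : Δ[1] _⦋m⦌) (h : ∀ k, x k ≤ y k) :
    ∃ z : Δ[2] _⦋m⦌, (simplexMap (proj 0)).app (op (.mk m)) z = x ∧
      (simplexMap (proj 1)).app (op (.mk m)) z = y := by
  let f (a b : Fin 2) : Fin 3 := ![![0, 1], ![2, 2]] a b
  have hf : ∀ a b a' b' : Fin 2, a ≤ a' → b ≤ b' → a' ≤ b' → f a b ≤ f a' b' := by decide
  have h₀ : ∀ a b : Fin 2, a ≤ b → proj 0 (f a b) = a := by decide
  have h₁ : ∀ a b : Fin 2, a ≤ b → proj 1 (f a b) = b := by decide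
  refine ⟨SSet.stdSimplex.objMk ⟨fun k ↦ f (x k) (y k), fun k l hkl ↦ ?_⟩, ?_, ?_⟩
  · exact hf _ _ _ _ (SSet.stdSimplex.monotone_apply x hkl)
      (SSet.stdSimplex.monotone_apply y hkl) (h l)
  · exact SSet.stdSimplex.ext _ _ fun k ↦ h₀ _ _ (h k)
  · exact SSet.stdSimplex.ext _ _ fun k ↦ h₁ _ _ (h k)

lemma simTriangle_jointly_surjective (e : Fin 2) :
    fibreDiagonal e ⊔ Subfunctor.range (simTriangle e (1 - e)) ⊔
      Subfunctor.range (simTriangle (1 - e) e) = ⊤ := by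
  suffices h : fibreDiagonal e ⊔ (Subfunctor.range (simTriangle 0 1) ⊔
      Subfunctor.range (simTriangle 1 0)) = ⊤ by
    rw [sup_assoc, ← h]
    congr 1
    fin_cases e
    exacts [rfl, sup_comm _ _]
  rw [← top_le_iff]
  rintro ⟨⟨⟨m⟩⟩ | _⟩ ⟨x, y⟩ -
  · obtain ⟨y, rfl⟩ := loop_surjective m y
    change (Δ[1] _⦋m⦌ : Type) at x
    right
    by_cases h : ∀ k, x k ≤ y k
    · obtain ⟨z, rfl, rfl⟩ := exists_proj_eq x y h
      exact Or.inl ⟨z, rfl⟩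
    -- A chain in the square cannot pass through both `(1, 0)` and `(0, 1)`, so one strict
    -- inequality `y k < x k` forces `y ≤ x` throughout.
    · obtain ⟨z, rfl, rfl⟩ := exists_proj_eq y x fun l ↦ by
        obtain ⟨k, hk⟩ := not_forall.1 h
        have key : ∀ a b a' b' : Fin 2, ¬ a ≤ b → (a ≤ a' ∧ b ≤ b' ∨ a' ≤ a ∧ b' ≤ b) →
          b' ≤ a' := by decide
        refine key _ _ _ _ hk ((le_total k l).imp ?_ ?_)
        all_goals
          exact fun hkl ↦ ⟨SSet.stdSimplex.monotone_apply x hkl,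
            SSet.stdSimplex.monotone_apply y hkl⟩
      exact Or.inr ⟨z, rfl⟩
  · exact Or.inl (witness_mem_fibreDiagonal e _)

lemma exists_of_notMem_epsHorn_two {e : Fin 2} {x : Δ[2] _⦋m⦌}
    (hx : x ∉ (epsHorn 2 (![0, 2] e)).obj (op (.simplex (.mk m)))) :
    (∃ k, x k = 1) ∧ ∃ k, x k = ![2, 0] e := by
  rw [mem_epsHorn_two_iff] at hx
  push Not at hx
  exact hx

end

variable {W : MorphismProperty EpsSSet} (hW : IsWeaklySaturated W) (hgen : basicGenerators ≤ W)

include hW hgen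

/-- The fibre over `e` is enlarged by the diagonal, then by the triangle with a side in this fibre,
then by the other triangle. The triangles are glued along 2-dimensional `ε`-horns, and together they
cover the square. -/
lemma epsHorn_one_whiskerRight_mem (e : Fin 2) : W ((epsHorn 1 e).ι ▷ red (sim 1)) := by
  have h₁ : W (epsHorn 1 e).ι := by
    fin_cases e
    exacts [hgen _ (.epsHornFirst 1 le_rfl), hgen _ (.epsHornLast 1 le_rfl)]
  have h₂ : W (epsHorn 2 (![0, 2] e)).ι := by
    fin_cases e
    exacts [hgen _ (.epsHornFirst 2 (by decide)), hgen _ (.epsHornLast 2 (by decide))]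
  have key₀ : ∀ e : Fin 2, e ≠ 1 - e := by decide
  refine whiskerRight_mem hW _ _ ?_
  rw [Subfunctor.range_ι]
  refine Subfunctor.ι_mem_of_extends_top hW (simTriangle_jointly_surjective e ▸
    ((extends_graph_fst hW h₁ (toRed (sim 1))).trans hW
      ((Subfunctor.Extends.sup_range hW _ (simTriangle e (1 - e)) ?_
        (preimage_simTriangle_first e ▸ h₂)).trans hW
      (Subfunctor.Extends.sup_range hW _ (simTriangle (1 - e) e) ?_
        (preimage_simTriangle_second e ▸ h₂)))))
  · rintro ⟨⟨⟨m⟩⟩ | _⟩ x y hx hy hxy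
    · change (Δ[2] _⦋m⦌ : Type) at x y
      replace hx : x ∉ (epsHorn 2 (![0, 2] e)).obj (op (.simplex (.mk m))) := by
        rw [← preimage_simTriangle_first]
        exact hx
      replace hy : y ∉ (epsHorn 2 (![0, 2] e)).obj (op (.simplex (.mk m))) := by
        rw [← preimage_simTriangle_first]
        exact hy
      obtain ⟨h, h' | ⟨h', h''⟩⟩ := (simTriangle_app_eq_iff _ _ _ _ x y).1 hxy
      · exact proj_injective e (1 - e) (key₀ e) x y h h'
      -- Both loop coordinates are constant, and both simplices pass through `![2, 0] e`, so the two
      -- constants coincide.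
      · obtain ⟨k, hk⟩ := (exists_of_notMem_epsHorn_two hx).2
        obtain ⟨l, hl⟩ := (exists_of_notMem_epsHorn_two hy).2
        refine proj_injective e (1 - e) (key₀ e) x y h fun i ↦ ?_
        rw [h' i k, h'' i l, hk, hl]
    · rfl
  · rintro ⟨⟨⟨m⟩⟩ | _⟩ x y hx hy hxy
    · change (Δ[2] _⦋m⦌ : Type) at x y
      replace hx : x ∉ (epsHorn 2 (![0, 2] e)).obj (op (.simplex (.mk m))) := by
        rw [← preimage_simTriangle_second]
        exact hx
      obtain ⟨h, h' | ⟨h', -⟩⟩ := (simTriangle_app_eq_iff _ _ _ _ x y).1 hxy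
      · exact proj_injective (1 - e) e (key₀ e).symm x y h h'
      -- Outside the horn the loop coordinate of the second triangle takes both values, so no
      -- identification occurs.
      · obtain ⟨⟨k, hk⟩, ⟨l, hl⟩⟩ := exists_of_notMem_epsHorn_two hx
        have key₁ : ∀ e : Fin 2, proj e 1 ≠ proj e (![2, 0] e) := by decide
        have := h' k l
        rw [hk, hl] at this
        exact absurd this (key₁ e)
    · rfl

end EpsSSet

/-! ### The braiding inclusions. -/

namespace EpsSSet

open Simplicial

/-- The simplices of the loop `(Δ^1)_red`. -/
noncomputable def unmarkedLoop {m : ℕ} (x : Δ[1] _⦋m⦌) :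
    (underlying (red (unmarked.obj Δ[1]))) _⦋m⦌ :=
  (toRed (unmarked.obj Δ[1])).app (op (.simplex (.mk m))) x

lemma unmarkedLoop_eq_of_const {m : ℕ} {x y : Δ[1] _⦋m⦌} (hx : ∀ i j, x i = x j)
    (hy : ∀ i j, y i = y j) : unmarkedLoop x = unmarkedLoop y :=
  (toRed_ofMarking_eq_iff x y).2 (Or.inr ⟨hx, hy⟩)

lemma unmarkedLoop_surjective (m : ℕ) : Function.Surjective (unmarkedLoop (m := m)) :=
  toRed_ofMarking_surjective _ _ _

lemma map_unmarkedLoop {m m' : ℕ} (f : SimplexCategory.mk m' ⟶ .mk m) (x : Δ[1] _⦋m⦌) :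
    (underlying (red (unmarked.obj Δ[1]))).map f.op (unmarkedLoop x) =
      unmarkedLoop (Δ[1].map f.op x) :=
  (NatTrans.naturality_apply (toRed (unmarked.obj Δ[1])) (EpsCat.incl.map f).op x).symm

/-- The inclusion of the loop without witnesses. -/
noncomputable def loopInclusion : red (unmarked.obj Δ[1]) ⟶ red (sim 1) :=
  pushout.desc (fromUnmarked (X := sim 1) (𝟙 _) ≫ toRed (sim 1))
    (pushout.inr (skZeroIncl (sim 1)) (skZeroToPoint (sim 1))) (by
      refine ((Category.assoc _ _ _).symm.trans (congrArg (· ≫ toRed (sim 1)) ?_)).trans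
        (pushout.condition (f := skZeroIncl (sim 1)) (g := skZeroToPoint (sim 1)))
      ext U s
      obtain ⟨_ | _⟩ := U
      · rfl
      · exact Empty.elim s)

lemma loopInclusion_app {m : ℕ} (x : Δ[1] _⦋m⦌) :
    loopInclusion.app (op (.simplex (.mk m))) (unmarkedLoop x) = loop x :=
  ConcreteCategory.congr_hom (NatTrans.congr_app (pushout.inl_desc
    (f := skZeroIncl (unmarked.obj Δ[1])) (g := skZeroToPoint (unmarked.obj Δ[1])) _ _ _)
      (op (.simplex (.mk m)))) x

/-- The simplices of the product of the cylinder and the loop. -/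
noncomputable def cylinderChart :
    SSet.Chart (Fin 2 × Fin 2 × Fin 2) (underlying (cylinder ⊗ red (sim 1))) where
  simplex {m} g :=
    ⟨⟨SSet.stdSimplex.objMk (n := .mk 1) (m := op (.mk m)) (OrderHom.fst.comp g),
      unmarkedLoop (SSet.stdSimplex.objMk ((OrderHom.fst.comp OrderHom.snd).comp g))⟩,
      loop (SSet.stdSimplex.objMk ((OrderHom.snd.comp OrderHom.snd).comp g))⟩
  δ_simplex g j := Prod.ext (Prod.ext rfl (map_unmarkedLoop _ _)) (map_loop _ _)
  surjective m := by
    rintro ⟨⟨x, y⟩, z⟩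
    obtain ⟨x, rfl⟩ := (SSet.stdSimplex.objMk_bijective (n := .mk 1) (m := op (.mk m))).2 x
    obtain ⟨y, rfl⟩ := unmarkedLoop_surjective m y
    obtain ⟨y, rfl⟩ := SSet.stdSimplex.objMk_bijective.2 y
    obtain ⟨z, rfl⟩ := loop_surjective m z
    obtain ⟨z, rfl⟩ := SSet.stdSimplex.objMk_bijective.2 z
    exact ⟨x.prod (y.prod z), rfl⟩

/-- The triangles of the product of the cylinder and the loop whose vertical and horizontal
coordinates are related by `R`, or which lie in a vertical line of the cylinder, or in one of the
sections of the projection to the cylinder given by a constant and by the horizontal coordinate. -/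
abbrev CylinderBase (R : Fin 2 → Fin 2 → Prop) (p q r : Fin 2 × Fin 2 × Fin 2) : Prop :=
  (R p.1 p.2.1 ∧ R q.1 q.2.1 ∧ R r.1 r.2.1) ∨ (p.2.1 = q.2.1 ∧ q.2.1 = r.2.1) ∨
    (p.2.2 = q.2.2 ∧ q.2.2 = r.2.2) ∨ (p.2.1 = p.2.2 ∧ q.2.1 = q.2.2 ∧ r.2.1 = r.2.2)

set_option synthInstance.maxHeartbeats 400000 in
set_option synthInstance.maxSize 4000 in
lemma cylinderLower_cases : ∀ p q r : Fin 2 × Fin 2 × Fin 2, p ≤ q → q ≤ r →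
    CylinderBase (· ≤ ·) p q r ∨
    (p, q, r) = ((0, 0, 0), (1, 0, 1), (1, 1, 1)) ∨ (p, q, r) = ((1, 0, 0), (1, 0, 1), (1, 1, 1)) ∨
    (p, q, r) = ((1, 0, 0), (1, 1, 0), (1, 1, 1)) := by
  decide +kernel

set_option synthInstance.maxHeartbeats 400000 in
set_option synthInstance.maxSize 4000 in
lemma cylinderUpper_cases : ∀ p q r : Fin 2 × Fin 2 × Fin 2, p ≤ q → q ≤ r →
    CylinderBase (· ≥ ·) p q r ∨
    (p, q, r) = ((0, 0, 0), (0, 0, 1), (0, 1, 1)) ∨ (p, q, r) = ((0, 0, 0), (0, 1, 0), (1, 1, 1)) ∨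
    (p, q, r) = ((0, 0, 0), (0, 1, 0), (0, 1, 1)) := by
  decide +kernel

section

variable {W : MorphismProperty SSet.{0}} (hW : IsWeaklySaturated W)
  (hcell : ∀ n ≥ 3, W (SSet.boundary n).ι) (hhorn : ∀ n ≥ 3, ∀ i, W (SSet.horn n i).ι)
  (A : (underlying (cylinder ⊗ red (sim 1))).Subcomplex)

include hW hcell hhorn

open SSet.Chart

lemma cylinder_lower_mem
    (hA : ∀ p q r h h', CylinderBase (· ≤ ·) p q r →
      cylinderChart.simplex (chainThree p q r h h') ∈ A.obj _) : W A.ι := by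
  have := fun m ↦ cylinderChart.finite m
  have base {p q r : Fin 2 × Fin 2 × Fin 2} (H : p ≤ q ∧ q ≤ r ∧ CylinderBase (· ≤ ·) p q r) :
      cylinderChart.Fills A p q r := ⟨H.1, H.2.1, .base _ (hA p q r _ _ H.2.2)⟩
  -- Coordinates are vertical, horizontal, loop. The triangles missing from the base are recovered
  -- from tetrahedra starting at `(0, 0, 0)`; `h₃` depends on `h₂`.
  have h₁ : cylinderChart.Fills A (1, 0, 0) (1, 1, 0) (1, 1, 1) :=
    .face_zero (p := (0, 0, 0)) (base (by decide)) (base (by decide)) (base (by decide))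
  have h₂ : cylinderChart.Fills A (0, 0, 0) (1, 0, 1) (1, 1, 1) :=
    .face_one (q := (0, 0, 1)) (base (by decide)) (base (by decide)) (base (by decide))
  have h₃ : cylinderChart.Fills A (1, 0, 0) (1, 0, 1) (1, 1, 1) :=
    .face_zero (p := (0, 0, 0)) h₂ (base (by decide)) (base (by decide))
  refine SSet.ι_mem_of_fill hW hcell (hhorn 3 le_rfl) A
    (cylinderChart.fill_of_fills fun p q r h h' ↦ ?_)
  obtain H | H | H | H := cylinderLower_cases p q r h h'
  · exact base ⟨h, h', H⟩
  all_goals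
    simp only [Prod.mk.injEq] at H
    obtain ⟨rfl, rfl, rfl⟩ := H
    assumption

lemma cylinder_upper_mem
    (hA : ∀ p q r h h', CylinderBase (· ≥ ·) p q r →
      cylinderChart.simplex (chainThree p q r h h') ∈ A.obj _) : W A.ι := by
  have := fun m ↦ cylinderChart.finite m
  have base {p q r : Fin 2 × Fin 2 × Fin 2} (H : p ≤ q ∧ q ≤ r ∧ CylinderBase (· ≥ ·) p q r) :
      cylinderChart.Fills A p q r := ⟨H.1, H.2.1, .base _ (hA p q r _ _ H.2.2)⟩
  -- The tetrahedra now end at `(1, 1, 1)` or `(1, 1, 0)` above the diagonal, or pass through the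
  -- latter; `h₃` depends on `h₂`.
  have h₁ : cylinderChart.Fills A (0, 0, 0) (0, 0, 1) (0, 1, 1) :=
    .face_three (s := (1, 1, 1)) (base (by decide)) (base (by decide)) (base (by decide))
  have h₂ : cylinderChart.Fills A (0, 0, 0) (0, 1, 0) (1, 1, 1) :=
    .face_two (r := (1, 1, 0)) (base (by decide)) (base (by decide)) (base (by decide))
  have h₃ : cylinderChart.Fills A (0, 0, 0) (0, 1, 0) (0, 1, 1) :=
    .face_three (s := (1, 1, 1)) (base (by decide)) (base (by decide)) h₂
  refine SSet.ι_mem_of_fill hW hcell (hhorn 3 le_rfl) A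
    (cylinderChart.fill_of_fills fun p q r h h' ↦ ?_)
  obtain H | H | H | H := cylinderUpper_cases p q r h h'
  · exact base ⟨h, h', H⟩
  all_goals
    simp only [Prod.mk.injEq] at H
    obtain ⟨rfl, rfl, rfl⟩ := H
    assumption

end

lemma cylinderTriangle_app {m : ℕ} (i j : Fin 2) (z : Δ[2] _⦋m⦌) :
    (cylinderTriangle i j).app (op (.simplex (.mk m))) z =
      ⟨(simplexMap (proj i)).app (op (.mk m)) z,
        unmarkedLoop ((simplexMap (proj j)).app (op (.mk m)) z)⟩ := by
  have key : ∀ (i : Fin 2) (v : Fin 3), i.predAbove v = proj i v := by decide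
  exact Prod.ext (SSet.stdSimplex.ext _ _ fun k ↦ key _ _)
    (congrArg unmarkedLoop (SSet.stdSimplex.ext _ _ fun k ↦ key _ _))

lemma mem_lowerTriangle {m : ℕ} (x y : Δ[1] _⦋m⦌)
    (h : (∀ k, x k ≤ y k) ∨ ∀ k l, y k = y l) :
    (⟨x, unmarkedLoop y⟩ : cylinder.obj (op (.simplex (.mk m)))) ∈ lowerTriangle.obj _ := by
  wlog h' : ∀ k, x k ≤ y k generalizing y
  -- A constant horizontal coordinate may be replaced by the constant 1, which is above every
  -- vertical coordinate.
  · have hy := h.resolve_left h'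
    rw [unmarkedLoop_eq_of_const (y := SSet.stdSimplex.const 1 1 _) hy fun _ _ ↦ rfl]
    exact this _ (Or.inr fun _ _ ↦ rfl) fun k ↦ Fin.le_last _
  obtain ⟨z, rfl, rfl⟩ := exists_proj_eq x y h'
  exact ⟨z, cylinderTriangle_app 0 1 z⟩

lemma mem_upperTriangle {m : ℕ} (x y : Δ[1] _⦋m⦌)
    (h : (∀ k, x k ≥ y k) ∨ ∀ k l, y k = y l) :
    (⟨x, unmarkedLoop y⟩ : cylinder.obj (op (.simplex (.mk m)))) ∈ upperTriangle.obj _ := by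
  wlog h' : ∀ k, x k ≥ y k generalizing y
  · have hy := h.resolve_left h'
    rw [unmarkedLoop_eq_of_const (y := SSet.stdSimplex.const 1 0 _) hy fun _ _ ↦ rfl]
    exact this _ (Or.inr fun _ _ ↦ rfl) fun k ↦ Fin.zero_le _
  obtain ⟨z, rfl, rfl⟩ := exists_proj_eq y x h'
  exact ⟨z, cylinderTriangle_app 1 0 z⟩

section

variable {W : MorphismProperty EpsSSet} (hW : IsWeaklySaturated W) (hgen : basicGenerators ≤ W)

include hW

/-- The two sections are the constant map and the horizontal coordinate, read in the loop with
witness. They agree only where the horizontal coordinate is constant, and these simplices lie in `T`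
by `hR`. The cylinder has no witnesses, so the rest is simplicial. -/
lemma triangle_whiskerRight_mem (T : Subfunctor cylinder) (hT : W T.ι) (R : Fin 2 → Fin 2 → Prop)
    (hR : ∀ (m : ℕ) (x y : Δ[1] _⦋m⦌), ((∀ k, R (x k) (y k)) ∨ ∀ k l, y k = y l) →
      (⟨x, unmarkedLoop y⟩ : cylinder.obj (op (.simplex (.mk m)))) ∈ T.obj _)
    (h : ∀ A : (underlying (cylinder ⊗ red (sim 1))).Subcomplex,
      (∀ p q r h h', CylinderBase R p q r →
        cylinderChart.simplex (chainThree p q r h h') ∈ A.obj _) → W (unmarked.map A.ι)) :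
    W (T.ι ▷ red (sim 1)) := by
  refine whiskerRight_mem hW _ _ ?_
  rw [Subfunctor.range_ι]
  obtain ⟨hle, H⟩ := extends_graph_graph hW hT
    (CartesianMonoidalCategory.fst _ _ ≫ simplexLoop (OrderHom.const _ 0))
    (CartesianMonoidalCategory.snd _ _ ≫ loopInclusion) (by
      rintro ⟨⟨⟨m⟩⟩ | _⟩ ⟨x, y⟩ hxy
      · obtain ⟨y, rfl⟩ := unmarkedLoop_surjective m y
        refine hR m x y (Or.inr ?_)
        have hxy : loop _ = loop y := hxy.trans (loopInclusion_app y)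
        obtain hy | ⟨-, hy⟩ := (loop_eq_iff _ _).1 hxy
        · exact fun _ _ ↦ hy ▸ rfl
        · exact hy
      · exact Empty.elim x)
  refine Subfunctor.Extends.ι_mem hW ⟨hle, H⟩
    (ι_mem_of_under hW _ (fun w ↦ Empty.elim w.1.1) (h _ ?_))
  intro p q r h h' H
  obtain H | H | H | H := H
  · refine Or.inl (Or.inl (hR 2 (SSet.stdSimplex.objMk _) (SSet.stdSimplex.objMk _)
      (Or.inl fun k ↦ ?_)))
    fin_cases k
    exacts [H.1, H.2.1, H.2.2]
  · refine Or.inl (Or.inl (hR 2 (SSet.stdSimplex.objMk _) (SSet.stdSimplex.objMk _)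
      (Or.inr fun i j ↦ ?_)))
    fin_cases i <;> fin_cases j
    exacts [rfl, H.1, H.1.trans H.2, H.1.symm, rfl, H.2, (H.1.trans H.2).symm, H.2.symm, rfl]
  · refine Or.inl (Or.inr ⟨_, Prod.ext rfl
      ((loop_eq_iff _ _).2 (Or.inr ⟨fun _ _ ↦ rfl, fun i j ↦ ?_⟩))⟩)
    fin_cases i <;> fin_cases j
    exacts [rfl, H.1, H.1.trans H.2, H.1.symm, rfl, H.2, (H.1.trans H.2).symm, H.2.symm, rfl]
  · refine Or.inr ⟨_, Prod.ext rfl ((loopInclusion_app _).trans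
      (congrArg loop (SSet.stdSimplex.ext _ _ fun i ↦ ?_)))⟩
    fin_cases i
    exacts [H.1, H.2.1, H.2.2]

include hgen

lemma lowerTriangle_whiskerRight_mem (h : W lowerTriangle.ι) :
    W (lowerTriangle.ι ▷ red (sim 1)) :=
  triangle_whiskerRight_mem hW _ h _ (fun _ ↦ mem_lowerTriangle) fun A hA ↦
    cylinder_lower_mem (hW.inverseImage unmarked) (cell_mem hgen) (horn_mem hgen) A hA

lemma upperTriangle_whiskerRight_mem (h : W upperTriangle.ι) :
    W (upperTriangle.ι ▷ red (sim 1)) :=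
  triangle_whiskerRight_mem hW _ h _ (fun _ ↦ mem_upperTriangle) fun A hA ↦
    cylinder_upper_mem (hW.inverseImage unmarked) (cell_mem hgen) (horn_mem hgen) A hA

end

end EpsSSet

/-! ### From generators to the two classes. -/

namespace EpsSSet

/-- Both products with the initial object are initial, so `sq.inr` is a pushout of an isomorphism,
and composing it with the pushout-product gives `f ▷ Y`. -/
lemma pushoutProduct_initial_mem {W : MorphismProperty EpsSSet} (hW : IsWeaklySaturated W)
    {A B : EpsSSet} (f : A ⟶ B) (Y : EpsSSet) (h : W (f ▷ Y)) :
    W ((MonoidalCategory.Arrow.pushoutProduct.obj (Arrow.mk f)).obj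
      (Arrow.mk (initial.to Y))).hom := by
  let sq := Functor.PushoutObjObj.ofHasPushout (curriedTensor EpsSSet) f (initial.to Y)
  have hi (Z : EpsSSet) : IsInitial (Z ⊗ ⊥_ EpsSSet) :=
    IsInitial.isInitialObj (tensorLeft Z) _ initialIsInitial
  have : IsIso (((curriedTensor EpsSSet).map f).app (⊥_ EpsSSet)) :=
    isIso_of_isInitial (hi A) (hi B) _
  have : IsIso sq.inr := sq.isPushout.isIso_inr_of_isIso
  refine hW.of_iso_comp (f := sq.inr) (g := sq.ι) ?_
  rwa [sq.inr_ι]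

lemma basicGenerators_whiskerRight_mem {W : MorphismProperty EpsSSet} (hW : IsWeaklySaturated W)
    (hgen : basicGenerators ≤ W) :
    basicGenerators ≤ W.inverseImage (tensorRight (red (sim 1))) := by
  rintro _ _ _ (⟨n, hn⟩ | ⟨n, hn⟩ | ⟨n, hn⟩ | _ | ⟨n, hn, i⟩)
  · obtain hn | rfl | rfl : 3 ≤ n ∨ n = 2 ∨ n = 1 := by lia
    · exact epsHorn_whiskerRight_mem hW hgen n hn 0 (Or.inl rfl)
    · exact epsHorn_two_whiskerRight_mem hW hgen 0 (Or.inl rfl)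
    · exact epsHorn_one_whiskerRight_mem hW hgen 0
  · obtain hn | rfl | rfl : 3 ≤ n ∨ n = 2 ∨ n = 1 := by lia
    · exact epsHorn_whiskerRight_mem hW hgen n hn _ (Or.inr rfl)
    · exact epsHorn_two_whiskerRight_mem hW hgen _ (Or.inr rfl)
    · exact epsHorn_one_whiskerRight_mem hW hgen 1
  · exact cell_whiskerRight_mem hW hgen n hn
  · exact assoc_whiskerRight_mem hW hgen
  · exact horn_whiskerRight_mem hW hgen n hn i

/-- Stated for any weakly saturated `W` containing the basic generators, so that it serves for
`classOne` and for the `classOne` part of `classTwo`. -/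
lemma classOne_whiskerRight_mem {W : MorphismProperty EpsSSet} (hW : IsWeaklySaturated W)
    (hgen : basicGenerators ≤ W) : classOne ≤ W.inverseImage (tensorRight (red (sim 1))) :=
  weakSaturation_le (hW.inverseImage _) (basicGenerators_whiskerRight_mem hW hgen)

lemma classTwo_whiskerRight_mem : classTwo ≤ classTwo.inverseImage (tensorRight (red (sim 1))) := by
  have hW : IsWeaklySaturated classTwo := isWeaklySaturated_weakSaturation _
  have hle : classOne ⊔ braiding ≤ classTwo := le_weakSaturation _
  have hgen : basicGenerators ≤ classTwo :=
    (le_weakSaturation _).trans (le_sup_left.trans hle)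
  refine weakSaturation_le (hW.inverseImage _) (sup_le (classOne_whiskerRight_mem hW hgen) ?_)
  rintro _ _ _ (_ | _)
  · exact lowerTriangle_whiskerRight_mem hW hgen (hle _ (Or.inr .lower))
  · exact upperTriangle_whiskerRight_mem hW hgen (hle _ (Or.inr .upper))

end EpsSSet

theorem mainTheorem11 :
    (∀ (A B : EpsSSet) (f : A ⟶ B), EpsSSet.classOne f →
      EpsSSet.classOne
        ((MonoidalCategory.Arrow.pushoutProduct.obj (CategoryTheory.Arrow.mk f)).obj
          (CategoryTheory.Arrow.mk (initial.to (EpsSSet.red (EpsSSet.sim 1))))).hom) ∧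
    (∀ (A B : EpsSSet) (f : A ⟶ B), EpsSSet.classTwo f →
      EpsSSet.classTwo
        ((MonoidalCategory.Arrow.pushoutProduct.obj (CategoryTheory.Arrow.mk f)).obj
          (CategoryTheory.Arrow.mk (initial.to (EpsSSet.red (EpsSSet.sim 1))))).hom) :=
  ⟨fun _ _ f hf ↦ EpsSSet.pushoutProduct_initial_mem (isWeaklySaturated_weakSaturation _) f _
      (EpsSSet.classOne_whiskerRight_mem (isWeaklySaturated_weakSaturation _)
        (le_weakSaturation _) f hf),
    fun _ _ f hf ↦ EpsSSet.pushoutProduct_initial_mem (isWeaklySaturated_weakSaturation _) f _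
      (EpsSSet.classTwo_whiskerRight_mem f hf)⟩
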